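/- Let $p_0=1$ and let $p_1=2<p_2=3<p_3=5<\dots$ be the primes. Let $\kappa_0(m)=1$ for all integers $m$, and for $k\ge 1$ let $\kappa_k(m)=0$ if $p_k\mid m$ and $\kappa_k(m)=1$ otherwise; since $\kappa_k(m)$ depends only on $m \bmod p_k$, $\kappa_k$ is also regarded as a function on $\mathbb Z/p_k\mathbb Z$. Let $\pi(x)$ be the number of primes $p\le x$. In the (unconstrained) random model of the primes, a random shift $a$ is given through its residues modulo the $p_k$, which are independent and uniformly distributed, and one sets $$\mathbf 1_{\mathrm{RM}}(n)=\prod_{k=0}^{\pi(\sqrt n)}\kappa_k(n+a)\quad(n\ge 1),\qquad \pi_{\mathrm{RM}}(x)=\sum_{i=1}^{\lfloor x\rfloor}\mathbf 1_{\mathrm{RM}}(i)-1 .$$ Put $W(y)=\prod_{p\le y}\left(1-\tfrac1p\right)$ (product over primes), $\operatorname{li}(x)=\int_2^x \frac{dt}{\log t}$, and let $\gamma$ be the Euler–Mascheroni constant. Then for every real $x\ge 1$ the random variable $\pi_{\mathrm{RM}}(x)$ is integrable and $$\mathbf E\left[\pi_{\mathrm{RM}}(x)\right]=\sum_{n=2}^{\lfloor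 x\rfloor}W(\sqrt n).$$ For each given $x\ge1$, the same holds when $a$ is any random integer whose residues modulo the $p_k$ with $0\le k\le\pi(\sqrt x)$ are independent and uniformly distributed. Moreover, as $x\to\infty$, $$\mathbf E\left[\pi_{\mathrm{RM}}(x)\right]\sim 2e^{-\gamma}\operatorname{li}(x)\qquad\text{and}\qquad \mathbf E\left[\pi_{\mathrm{RM}}(x)\right]\sim 2e^{-\gamma}\,\pi(x).$$ -/

import Mathlib

open MeasureTheory ProbabilityTheory Filter Asymptotics

namespace RandomPrimes

/-- The periods `p₀ = 1`, `p₁ = 2`, `p₂ = 3`, `p₃ = 5`, … : `p k` is the `k`-th prime for `k ≥ 1`,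
and `p 0 = 1` is the period of the unit sequence. -/
noncomputable def p : ℕ → ℕ
  | 0 => 1
  | k + 1 => Nat.nth Nat.Prime k

instance instNeZeroP (k : ℕ) : NeZero (p k) := by
  cases k with
  | zero => exact ⟨one_ne_zero⟩
  | succ k => exact ⟨(Nat.prime_nth_prime k).ne_zero⟩

/-- The prime counting function `π(x)` of a real variable. -/
noncomputable def primePi (x : ℝ) : ℕ := Nat.primeCounting ⌊x⌋₊

/-- The periodic sequence `κ_k`, as a function of the residue class modulo its period `p k`:
`κ_0 = 1` identically, and for `k ≥ 1` it is `0` on the multiples of `p k` and `1` elsewhere. -/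
noncomputable def kappa (k : ℕ) (r : ZMod (p k)) : ℝ :=
  open scoped Classical in if k ≠ 0 ∧ r = 0 then 0 else 1

/-- The sample space: a shift `a` is recorded through its residues modulo all the `p k`. -/
abbrev Shift : Type := (k : ℕ) → ZMod (p k)

/-- The shift given by an integer. -/
noncomputable def intShift (a : ℤ) : Shift := fun k => (a : ZMod (p k))

/-- The law of the random shift: the residues modulo the `p k` are independent, and each one is
uniformly distributed. -/
noncomputable def rmLaw : Measure Shift :=
  Measure.infinitePi fun k => uniformOn (Set.univ : Set (ZMod (p k)))

instance instIsProbabilityMeasureRmLaw : IsProbabilityMeasure rmLaw := by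
  unfold rmLaw; infer_instance

/-- The characteristic function `∏_{k=0}^{π(√n)} κ_k(n + a)` of the "primes" of the random model
with shift `a`. -/
noncomputable def charRM (a : Shift) (n : ℕ) : ℝ :=
  ∏ k ∈ Finset.range (primePi √(n : ℝ) + 1), kappa k ((n : ZMod (p k)) + a k)

/-- The counting function `∑_{i=1}^{⌊x⌋} 1_RM(i) - 1` of the random model with shift `a`; the
position `1`, which is always counted as a "prime", is taken off. -/
noncomputable def piRM (a : Shift) (x : ℝ) : ℝ :=
  ∑ i ∈ Finset.Icc 1 ⌊x⌋₊, charRM a i - 1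

/-- `W(x) = ∏_{p ≤ x} (1 - 1/p)`, the product over primes. -/
noncomputable def W (x : ℝ) : ℝ := ∏ q ∈ Nat.primesLE ⌊x⌋₊, (1 - 1 / (q : ℝ))

/-- The logarithmic integral `∫_2^x dt / log t`. -/
noncomputable def li (x : ℝ) : ℝ := ∫ t in (2 : ℝ)..x, 1 / Real.log t

/-- `a` is a random integer whose residues modulo `p 0, …, p K` are independent and uniform:
every system of residues has probability `∏_{k ≤ K} 1 / p k`. -/
def IsRandomShift {Ω : Type*} [MeasurableSpace Ω] (P : Measure Ω) (a : Ω → ℤ) (K : ℕ) : Prop :=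
  Measurable a ∧ ∀ b : ℕ → ℤ,
    P {ω | ∀ k ≤ K, a ω ≡ b k [ZMOD (p k : ℤ)]} =
      ∏ k ∈ Finset.range (K + 1), (p k : ENNReal)⁻¹

end RandomPrimes

namespace RandomPrimes

open Topology

/-! The indicator at `n` is a product of functions of separate residues. By independence its
expectation is the product of the factors 1 - 1/p over p ≤ √n, which is W(√n). For fixed x only
finitely many residues enter, so both kinds of shift reduce to the same finite product law
(`UniformResidues`).

For the asymptotics, Mertens' third theorem (`tendsto_W_mul_log`) gives W(√n) ~ e^{-γ} / log √n =
2e^{-γ} / log n, and comparing the sum of 1 / log n with an integral produces li. The form with π(x)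
then needs the prime number theorem (`primePi_isEquivalent`) together with li x ~ x / log x.

The prime number theorem comes from a Tauberian argument (`tendsto_zero_of_laplace`). The function
ψ(e^u)e^{-u} - 1 is bounded, and its Laplace transform extends continuously to the imaginary axis,
because -ζ'/ζ minus its pole extends to Re s = 1. The Riemann–Lebesgue lemma makes the Fejér means
tend to 0, and the monotonicity of ψ turns this into pointwise convergence.

For Mertens, Chebyshev's analysis of log N! and Abel summation give ∑ 1/p = log log x + β + o(1).
The constant is found by computing the limit of log ζ(s) + log(s - 1) as s → 1⁺ in two ways
(`add_tsum_primeTail_eq`); γ enters as -Γ'(1). -/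

/-! ### Expectations under independent uniform residues -/

lemma uniformOn_zmod_singleton (k : ℕ) (r : ZMod (p k)) :
    uniformOn (Set.univ : Set (ZMod (p k))) {r} = (p k : ENNReal)⁻¹ := by
  rw [uniformOn_univ, Measure.count_singleton, ZMod.card, one_div]

/-- The expectation of `κ_k` at a uniform residue. -/
lemma integral_kappa (k n : ℕ) :
    ∫ r, kappa k ((n : ZMod (p k)) + r) ∂(uniformOn Set.univ) =
      if k = 0 then 1 else 1 - 1 / (p k : ℝ) := by
  classical
  rcases eq_or_ne k 0 with rfl | hk
  · simp [kappa]
  · have h : ∀ r : ZMod (p k), kappa k ((n : ZMod (p k)) + r) =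
        1 - Set.indicator {-(n : ZMod (p k))} (fun _ => (1 : ℝ)) r := by
      intro r
      by_cases hr : r = -(n : ZMod (p k))
      · simp [kappa, hk, hr]
      · have : (n : ZMod (p k)) + r ≠ 0 := fun h => hr (eq_neg_of_add_eq_zero_right h)
        simp [kappa, this, hr]
    simp_rw [h]
    rw [integral_sub (integrable_const _) ((integrable_const _).indicator (by measurability)),
      integral_indicator (by measurability)]
    simp [measureReal_def, uniformOn_zmod_singleton, hk]

lemma norm_kappa_le_one (k : ℕ) (r : ZMod (p k)) : ‖kappa k r‖ ≤ 1 := by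
  unfold kappa
  split_ifs <;> simp

lemma prod_range_count_nth_prime (f : ℕ → ℝ) (N : ℕ) :
    ∏ k ∈ Finset.range (Nat.count Nat.Prime N), f (Nat.nth Nat.Prime k) =
      ∏ q ∈ Finset.range N with q.Prime, f q := by
  induction N with
  | zero => simp
  | succ N ih =>
    rw [Nat.count_succ, Finset.range_add_one, Finset.filter_insert]
    split_ifs with h
    · rw [Finset.prod_range_succ, ih, Nat.nth_count h, Finset.prod_insert (by simp), mul_comm]
    · simpa using ih

lemma prod_range_primePi (x : ℝ) :
    ∏ k ∈ Finset.range (primePi x + 1), (if k = 0 then (1 : ℝ) else 1 - 1 / (p k : ℝ)) = W x := by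
  rw [Finset.prod_range_succ']
  simp only [Nat.add_eq_zero_iff, one_ne_zero, and_false, if_false, if_true, mul_one]
  rw [W, Nat.primesLE_eq_filter_range]
  exact prod_range_count_nth_prime (fun q => 1 - 1 / (q : ℝ)) _

/-- The residues modulo `p 0, …, p K` of the shift `X` are independent and uniform. -/
def UniformResidues {Ω : Type*} [MeasurableSpace Ω] (P : Measure Ω) (X : Ω → Shift)
    (K : ℕ) : Prop :=
  Measurable (fun ω => (Finset.range (K + 1)).restrict (X ω)) ∧
    P.map (fun ω => (Finset.range (K + 1)).restrict (X ω)) =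
      Measure.pi fun k : Finset.range (K + 1) => uniformOn (Set.univ : Set (ZMod (p k)))

lemma uniformResidues_rmLaw (K : ℕ) : UniformResidues rmLaw id K :=
  ⟨Finset.measurable_restrict _, Measure.infinitePi_map_restrict _⟩

/-- A measure on a finite product of finite sets is determined by its point masses, and the preimage
of a point is exactly a system of congruences as in `IsRandomShift`. -/
lemma IsRandomShift.uniformResidues {Ω : Type*} [MeasurableSpace Ω] {P : Measure Ω} {a : Ω → ℤ}
    {K : ℕ} (h : IsRandomShift P a K) : UniformResidues P (fun ω => intShift (a ω)) K := by
  have hm : Measurable (fun ω => (Finset.range (K + 1)).restrict (intShift (a ω))) := by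
    have : Measurable (fun z : ℤ => (Finset.range (K + 1)).restrict (intShift z)) :=
      measurable_from_top
    exact this.comp h.1
  refine ⟨hm, Measure.ext_of_singleton fun y => ?_⟩
  classical
  rw [Measure.map_apply hm (measurableSet_singleton y), Measure.pi_singleton]
  have hb := h.2 fun k => if hk : k ∈ Finset.range (K + 1) then ((y ⟨k, hk⟩).val : ℤ) else 0
  have hs : {ω | ∀ k ≤ K, a ω ≡ (if hk : k ∈ Finset.range (K + 1) then
      ((y ⟨k, hk⟩).val : ℤ) else 0) [ZMOD (p k : ℤ)]} =
      (fun ω => (Finset.range (K + 1)).restrict (intShift (a ω))) ⁻¹' {y} := by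
    ext ω
    simp only [Set.mem_ofPred_eq, Set.mem_preimage, Set.mem_singleton_iff, funext_iff,
      Subtype.forall, Finset.restrict, intShift]
    refine forall_congr' fun k => ?_
    rw [← Nat.lt_add_one_iff, ← Finset.mem_range]
    refine forall_congr' fun hk => ?_
    rw [dif_pos hk, ← ZMod.intCast_eq_intCast_iff]
    simp
  rw [← hs, hb, ← Finset.prod_coe_sort]
  exact Finset.prod_congr rfl fun k _ => (uniformOn_zmod_singleton _ _).symm

/-- Padding with factors 1 makes every relevant indicator a product over the same index set, as the
product formula for integrals over a product measure requires. -/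
lemma charRM_eq_prod_restrict {n K : ℕ} (h : primePi √(n : ℝ) ≤ K) (a : Shift) :
    charRM a n = ∏ k : Finset.range (K + 1), (if (k : ℕ) ∈ Finset.range (primePi √(n : ℝ) + 1)
      then kappa k ((n : ZMod (p k)) + (Finset.range (K + 1)).restrict a k) else 1) := by
  simp only [Finset.restrict]
  rw [Finset.prod_coe_sort (Finset.range (K + 1)) (fun k =>
    if k ∈ Finset.range (primePi √(n : ℝ) + 1) then kappa k ((n : ZMod (p k)) + a k) else 1),
    Finset.prod_ite_mem, Finset.inter_eq_right.2 (Finset.range_mono (by omega)), charRM]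

section
variable {Ω : Type*} [MeasurableSpace Ω] {P : Measure Ω} {X : Ω → Shift}

lemma integrable_charRM [IsProbabilityMeasure P] {n K : ℕ} (h : primePi √(n : ℝ) ≤ K)
    (hX : UniformResidues P X K) :
    Integrable (fun ω => charRM (X ω) n) P := by
  simp_rw [charRM_eq_prod_restrict h]
  have hm : Measurable (fun y : (k : Finset.range (K + 1)) → ZMod (p k) =>
      ∏ k : Finset.range (K + 1), (if (k : ℕ) ∈ Finset.range (primePi √(n : ℝ) + 1)
      then kappa k ((n : ZMod (p k)) + y k) else 1)) := measurable_of_finite _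
  refine Integrable.of_bound (hm.comp hX.1).aestronglyMeasurable 1 (ae_of_all _ fun ω => ?_)
  rw [norm_prod]
  refine Finset.prod_le_one (fun _ _ => norm_nonneg _) fun k _ => ?_
  split_ifs
  · exact norm_kappa_le_one _ _
  · simp

/-- The probability that `n` is a "prime" of the random model. -/
lemma integral_charRM {n K : ℕ} (h : primePi √(n : ℝ) ≤ K) (hX : UniformResidues P X K) :
    ∫ ω, charRM (X ω) n ∂P = W √(n : ℝ) := by
  simp_rw [charRM_eq_prod_restrict h]
  have hm : Measurable (fun y : (k : Finset.range (K + 1)) → ZMod (p k) =>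
      ∏ k : Finset.range (K + 1), (if (k : ℕ) ∈ Finset.range (primePi √(n : ℝ) + 1)
      then kappa k ((n : ZMod (p k)) + y k) else 1)) := measurable_of_finite _
  rw [← integral_map (φ := fun ω => (Finset.range (K + 1)).restrict (X ω)) hX.1.aemeasurable
    (f := fun y => ∏ k : Finset.range (K + 1), (if (k : ℕ) ∈ Finset.range (primePi √(n : ℝ) + 1)
      then kappa k ((n : ZMod (p k)) + y k) else 1)) hm.aestronglyMeasurable, hX.2,
    integral_fintype_prod_eq_prod (f := fun (k : Finset.range (K + 1)) (r : ZMod (p k)) =>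
      if (k : ℕ) ∈ Finset.range (primePi √(n : ℝ) + 1) then kappa k ((n : ZMod (p k)) + r) else 1)]
  have : ∀ k : Finset.range (K + 1), (∫ r, (if (k : ℕ) ∈ Finset.range (primePi √(n : ℝ) + 1)
      then kappa k ((n : ZMod (p k)) + r) else 1) ∂(uniformOn (Set.univ : Set (ZMod (p k))))) =
      if (k : ℕ) ∈ Finset.range (primePi √(n : ℝ) + 1) then
        (if (k : ℕ) = 0 then (1 : ℝ) else 1 - 1 / (p k : ℝ)) else 1 := by
    intro k
    by_cases h1 : (k : ℕ) ∈ Finset.range (primePi √(n : ℝ) + 1)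
    · simp_rw [if_pos h1, integral_kappa]
    · simp_rw [if_neg h1]
      simp
  rw [Finset.prod_congr rfl fun k _ => this k, Finset.prod_coe_sort (Finset.range (K + 1)) (fun k =>
    if k ∈ Finset.range (primePi √(n : ℝ) + 1) then
        (if k = 0 then (1 : ℝ) else 1 - 1 / (p k : ℝ)) else 1),
    Finset.prod_ite_mem, Finset.inter_eq_right.2 (Finset.range_mono (by omega)),
    prod_range_primePi]

lemma W_one : W 1 = 1 := by simp [W]

lemma integrable_piRM_and_integral_piRM [IsProbabilityMeasure P] {x : ℝ} (hx : 1 ≤ x)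
    (hX : UniformResidues P X (primePi √x)) :
    Integrable (fun ω => piRM (X ω) x) P ∧
      ∫ ω, piRM (X ω) x ∂P = ∑ n ∈ Finset.Icc 2 ⌊x⌋₊, W √(n : ℝ) := by
  have hle : ∀ i ∈ Finset.Icc 1 ⌊x⌋₊, primePi √(i : ℝ) ≤ primePi √x := fun i hi =>
    Nat.monotone_primeCounting <| Nat.floor_mono <| Real.sqrt_le_sqrt <|
      (Nat.cast_le.2 (Finset.mem_Icc.1 hi).2).trans (Nat.floor_le (by linarith))
  have hi : Integrable (fun ω => ∑ i ∈ Finset.Icc 1 ⌊x⌋₊, charRM (X ω) i) P :=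
    integrable_finsetSum _ fun i hi => integrable_charRM (hle i hi) hX
  refine ⟨hi.sub (integrable_const 1), ?_⟩
  unfold piRM
  rw [integral_sub hi (integrable_const 1),
    integral_finsetSum _ fun i hi => integrable_charRM (hle i hi) hX,
    Finset.sum_congr rfl fun i hi => integral_charRM (hle i hi) hX,
    ← Finset.add_sum_Ioc_eq_sum_Icc (Nat.le_floor (by simpa using hx))]
  -- The term n = 1, split off above, equals `W 1 = 1` and cancels the subtracted 1.
  simp [W_one, ← Finset.Icc_add_one_left_eq_Ioc]

end

/-! ### The Fejér kernel -/

/-- The Fejér kernel, as the Fourier transform of the triangle function. -/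
noncomputable def fejer (x : ℝ) : ℝ := ∫ t in (-1 : ℝ)..1, (1 - |t|) * Real.cos (t * x)

lemma continuous_fejer : Continuous fejer := by
  unfold fejer
  exact intervalIntegral.continuous_parametric_intervalIntegral_of_continuous' (by fun_prop) _ _

lemma integral_triangle_mul_sin (x : ℝ) :
    ∫ t in (-1 : ℝ)..1, (1 - |t|) * Real.sin (t * x) = 0 := by
  have h := intervalIntegral.integral_comp_neg (a := -1) (b := 1)
    (fun t : ℝ => (1 - |t|) * Real.sin (t * x))
  simp only [abs_neg, neg_mul, Real.sin_neg, mul_neg, intervalIntegral.integral_neg, neg_neg] at h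
  linarith

lemma integral_triangle_mul_exp (x : ℝ) :
    ∫ t in (-1 : ℝ)..1, ((1 - |t| : ℝ) : ℂ) * Complex.exp (Complex.I * t * x) = fejer x := by
  have h : ∀ t : ℝ, ((1 - |t| : ℝ) : ℂ) * Complex.exp (Complex.I * t * x) =
      (((1 - |t|) * Real.cos (t * x) : ℝ) : ℂ) +
        (((1 - |t|) * Real.sin (t * x) : ℝ) : ℂ) * Complex.I := by
    intro t
    rw [show Complex.I * t * x = ((t * x : ℝ) : ℂ) * Complex.I by push_cast; ring,
      Complex.exp_mul_I]
    push_cast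
    ring
  simp_rw [h]
  rw [intervalIntegral.integral_add, intervalIntegral.integral_mul_const,
    intervalIntegral.integral_ofReal, intervalIntegral.integral_ofReal,
    integral_triangle_mul_sin, fejer]
  · simp
  all_goals exact Continuous.intervalIntegrable (by fun_prop) _ _

lemma fejer_eq {x : ℝ} (hx : x ≠ 0) : fejer x = 2 * (1 - Real.cos x) / x ^ 2 := by
  have hc : Continuous fun t : ℝ => (1 - |t|) * Real.cos (t * x) := by fun_prop
  have h0 := intervalIntegral.integral_comp_neg (a := 0) (b := 1)
    (fun t : ℝ => (1 - |t|) * Real.cos (t * x))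
  simp only [abs_neg, neg_mul, Real.cos_neg, neg_zero] at h0
  rw [fejer, ← intervalIntegral.integral_add_adjacent_intervals (b := 0)
    (hc.intervalIntegrable _ _) (hc.intervalIntegrable _ _), ← h0]
  have h1 : ∫ t in (0 : ℝ)..1, (1 - |t|) * Real.cos (t * x) =
      ∫ t in (0 : ℝ)..1, (1 - t) * Real.cos (t * x) := by
    refine intervalIntegral.integral_congr fun t ht => ?_
    rw [Set.uIcc_of_le zero_le_one] at ht
    simp only [abs_of_nonneg ht.1]
  have h2 : ∫ t in (0 : ℝ)..1, (1 - t) * Real.cos (t * x) = (1 - Real.cos x) / x ^ 2 := by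
    rw [intervalIntegral.integral_eq_sub_of_hasDerivAt
      (f := fun t => (1 - t) * Real.sin (t * x) / x - Real.cos (t * x) / x ^ 2)]
    · simp
      ring
    · intro t _
      have hl : HasDerivAt (fun t : ℝ => t * x) x t := by simpa using (hasDerivAt_id t).mul_const x
      have := ((((hasDerivAt_id t).const_sub 1).mul hl.sin).div_const x).sub
        (hl.cos.div_const (x ^ 2))
      refine this.congr_deriv ?_
      simp only [id]
      field_simp
      ring
    · exact Continuous.intervalIntegrable (by fun_prop) _ _
  rw [h1, h2]
  ring

lemma fejer_nonneg (x : ℝ) : 0 ≤ fejer x := by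
  rcases eq_or_ne x 0 with rfl | hx
  · refine intervalIntegral.integral_nonneg (by norm_num) fun t ht => ?_
    have := abs_le.2 ht
    simp [this]
  · rw [fejer_eq hx]
    have := Real.cos_le_one x
    have : 0 ≤ 1 - Real.cos x := by linarith
    positivity

lemma fejer_le_two (x : ℝ) : fejer x ≤ 2 := by
  have h := intervalIntegral.norm_integral_le_of_norm_le_const (a := -1) (b := 1) (C := 1)
    (f := fun t : ℝ => (1 - |t|) * Real.cos (t * x)) fun t ht => by
      rw [Set.uIoc_of_le (by norm_num)] at ht
      have h1 : |t| ≤ 1 := abs_le.2 ⟨ht.1.le, ht.2⟩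
      rw [norm_mul]
      refine mul_le_one₀ ?_ (norm_nonneg _) (Real.abs_cos_le_one _)
      rw [Real.norm_of_nonneg (by linarith)]
      linarith [abs_nonneg t]
  have := le_abs_self (fejer x)
  rw [Real.norm_eq_abs] at h
  norm_num at h
  exact this.trans h

lemma fejer_le (x : ℝ) : fejer x ≤ 10 * (1 + x ^ 2)⁻¹ := by
  rw [← div_eq_mul_inv, le_div_iff₀ (by positivity)]
  -- The constant 10 is 2 · (1 + 4) from the bound 2 on the near range; on the far range the kernel
  -- is at most 4 / x².
  rcases le_or_gt (x ^ 2) 4 with h | h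
  · nlinarith [fejer_le_two x, fejer_nonneg x]
  · have hx : x ≠ 0 := by rintro rfl; norm_num at h
    rw [fejer_eq hx, div_mul_eq_mul_div, div_le_iff₀ (by positivity)]
    nlinarith [Real.neg_one_le_cos x, Real.cos_le_one x]

lemma integrable_fejer : Integrable fejer :=
  (integrable_inv_one_add_sq.const_mul 10).mono' continuous_fejer.aestronglyMeasurable
    (ae_of_all _ fun x => by rw [Real.norm_of_nonneg (fejer_nonneg x)]; exact fejer_le x)

lemma integral_fejer_pos : 0 < ∫ x, fejer x := by
  refine integral_pos_of_integrable_nonneg_nonzero (x := Real.pi) continuous_fejer integrable_fejer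
    fejer_nonneg ?_
  rw [fejer_eq Real.pi_ne_zero, Real.cos_pi]
  positivity

/-! ### A Tauberian theorem for Laplace transforms -/

section
variable {a : ℝ → ℝ} {C : ℝ} {F : ℂ → ℂ}

lemma integrable_mul_exp_neg (ha : Measurable a) (hC : ∀ u, |a u| ≤ C) (h0 : ∀ u ≤ 0, a u = 0)
    {σ : ℝ} (hσ : 0 < σ) : Integrable (fun u => a u * Real.exp (-σ * u)) := by
  have h1 : Integrable ((Set.Ioi (0 : ℝ)).indicator fun u => C * Real.exp (-σ * u)) :=
    (integrable_indicator_iff measurableSet_Ioi).2 ((exp_neg_integrableOn_Ioi 0 hσ).const_mul C)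
  refine h1.mono' (by fun_prop) (ae_of_all _ fun u => ?_)
  by_cases hu : u ≤ 0
  · simp [h0 u hu, hu]
  · rw [Set.indicator_of_mem (by simpa using hu), norm_mul, Real.norm_eq_abs,
      Real.norm_of_nonneg (Real.exp_pos _).le]
    exact mul_le_mul_of_nonneg_right (hC u) (Real.exp_pos _).le

/-- The damping e^{-σu} makes the double integral over t and u absolutely convergent, so Fubini
applies once the kernel is written as a Fourier integral. -/
lemma integral_mul_exp_mul_fejer (ha : Measurable a) (hC : ∀ u, |a u| ≤ C)
    (h0 : ∀ u ≤ 0, a u = 0)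
    (hF : ∀ s : ℂ, 0 < s.re → F s = ∫ u, (a u : ℂ) * Complex.exp (-s * u))
    {σ : ℝ} (hσ : 0 < σ) (l T : ℝ) :
    ((∫ u, a u * Real.exp (-σ * u) * fejer (l * (T - u)) : ℝ) : ℂ) =
      ∫ t in (-1 : ℝ)..1, ((1 - |t| : ℝ) : ℂ) * Complex.exp (Complex.I * t * (l * T)) *
        F (σ + Complex.I * (l * t)) := by
  have hint := integrable_mul_exp_neg ha hC h0 hσ
  have hprod : Integrable (Function.uncurry fun (t u : ℝ) =>
      Complex.exp (Complex.I * t * (l * (T - u))) *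
        (((1 - |t| : ℝ) : ℂ) * ((a u * Real.exp (-σ * u) : ℝ) : ℂ)))
      ((volume.restrict (Set.uIoc (-1 : ℝ) 1)).prod volume) := by
    have hk : Integrable (fun t : ℝ => ((1 - |t| : ℝ) : ℂ))
        (volume.restrict (Set.uIoc (-1 : ℝ) 1)) :=
      (Continuous.integrableOn_uIoc (by fun_prop))
    have := (hk.mul_prod (hint.ofReal (𝕜 := ℂ)))
    refine this.bdd_mul (c := 1) ?_ (ae_of_all _ fun z => ?_)
    · exact Continuous.aestronglyMeasurable (by fun_prop)
    · rw [show Complex.I * z.1 * (l * (T - z.2)) = ((z.1 * (l * (T - z.2)) : ℝ) : ℂ) * Complex.I by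
        push_cast; ring, Complex.norm_exp_ofReal_mul_I]
  have hsw := intervalIntegral_integral_swap hprod
  have h1 : ∀ u : ℝ, ((a u * Real.exp (-σ * u) * fejer (l * (T - u)) : ℝ) : ℂ) =
      ∫ t in (-1 : ℝ)..1, Complex.exp (Complex.I * t * (l * (T - u))) *
        (((1 - |t| : ℝ) : ℂ) * ((a u * Real.exp (-σ * u) : ℝ) : ℂ)) := by
    intro u
    rw [Complex.ofReal_mul, ← integral_triangle_mul_exp, ← intervalIntegral.integral_const_mul]
    refine intervalIntegral.integral_congr fun t _ => ?_
    push_cast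
    ring
  calc _ = ∫ u : ℝ, ∫ t in (-1 : ℝ)..1, Complex.exp (Complex.I * t * (l * (T - u))) *
        (((1 - |t| : ℝ) : ℂ) * ((a u * Real.exp (-σ * u) : ℝ) : ℂ)) :=
          integral_complex_ofReal.symm.trans (integral_congr_ae (ae_of_all _ h1))
    _ = _ := by
      rw [← hsw]
      refine intervalIntegral.integral_congr fun t _ => ?_
      rw [hF _ (by simpa using hσ), ← integral_const_mul]
      refine integral_congr_ae (ae_of_all _ fun u => ?_)
      simp only
      push_cast
      have : Complex.exp (-(σ + Complex.I * (l * t)) * u) =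
          Complex.exp (-σ * u) * Complex.exp (-(Complex.I * (l * t)) * u) := by
        rw [← Complex.exp_add]; ring_nf
      have h2 : Complex.exp (Complex.I * t * (l * (T - u))) =
          Complex.exp (Complex.I * t * (l * T)) * Complex.exp (-(Complex.I * (l * t)) * u) := by
        rw [← Complex.exp_add]; ring_nf
      rw [this, h2]
      ring

lemma integrable_fejer_comp {l : ℝ} (hl : l ≠ 0) (T : ℝ) :
    Integrable (fun u => fejer (l * (T - u))) := by
  have h := (integrable_fejer.comp_mul_left' hl).comp_sub_left T
  exact h

/-- This is the limit σ → 0⁺ of the damped identity. The left side is dominated by a multiple of the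
integrable kernel, the right side by a bound for `F` on a compact rectangle touching the imaginary
axis. -/
lemma integral_mul_fejer (ha : Measurable a) (hC : ∀ u, |a u| ≤ C)
    (h0 : ∀ u ≤ 0, a u = 0) (hcont : ContinuousOn F {s | 0 ≤ s.re})
    (hF : ∀ s : ℂ, 0 < s.re → F s = ∫ u, (a u : ℂ) * Complex.exp (-s * u))
    {l : ℝ} (hl : l ≠ 0) (T : ℝ) :
    ((∫ u, a u * fejer (l * (T - u)) : ℝ) : ℂ) =
      ∫ t in (-1 : ℝ)..1, ((1 - |t| : ℝ) : ℂ) * Complex.exp (Complex.I * t * (l * T)) *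
        F (Complex.I * (l * t)) := by
  have hK : ContinuousOn (fun z : ℝ × ℝ => F (z.1 + Complex.I * (l * z.2)))
      (Set.Icc 0 1 ×ˢ Set.Icc (-1) 1) :=
    hcont.comp (Continuous.continuousOn (by fun_prop)) fun z hz => by simpa using hz.1.1
  obtain ⟨M, hM⟩ := (isCompact_Icc.prod isCompact_Icc).exists_bound_of_continuousOn hK
  have hlim1 : Tendsto (fun σ : ℝ => ((∫ u, a u * Real.exp (-σ * u) * fejer (l * (T - u)) : ℝ) : ℂ))
      (𝓝[>] 0) (𝓝 ((∫ u, a u * fejer (l * (T - u)) : ℝ) : ℂ)) := by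
    refine (Complex.continuous_ofReal.tendsto _).comp ?_
    refine tendsto_integral_filter_of_dominated_convergence (fun u => C * fejer (l * (T - u)))
      (Eventually.of_forall fun σ => ?_) ?_ ((integrable_fejer_comp hl T).const_mul C) ?_
    · have := continuous_fejer.measurable
      exact Measurable.aestronglyMeasurable (by fun_prop)
    · filter_upwards [self_mem_nhdsWithin] with σ hσ
      refine ae_of_all _ fun u => ?_
      rw [norm_mul, Real.norm_of_nonneg (fejer_nonneg _)]
      refine mul_le_mul_of_nonneg_right ?_ (fejer_nonneg _)
      by_cases hu : u ≤ 0
      · simpa [h0 u hu] using (abs_nonneg _).trans (hC u)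
      · rw [norm_mul, Real.norm_eq_abs, Real.norm_of_nonneg (Real.exp_pos _).le]
        refine (mul_le_of_le_one_right (abs_nonneg _) (Real.exp_le_one_iff.2 ?_)).trans (hC u)
        have : 0 < σ := hσ
        nlinarith
    · refine ae_of_all _ fun u => ?_
      have : Tendsto (fun σ : ℝ => a u * Real.exp (-σ * u) * fejer (l * (T - u))) (𝓝 0)
          (𝓝 (a u * Real.exp (-0 * u) * fejer (l * (T - u)))) :=
        Continuous.tendsto (by fun_prop) 0
      simp only [neg_zero, zero_mul, Real.exp_zero, mul_one] at this
      exact this.mono_left nhdsWithin_le_nhds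
  have hlim2 : Tendsto (fun σ : ℝ => ∫ t in (-1 : ℝ)..1, ((1 - |t| : ℝ) : ℂ) *
        Complex.exp (Complex.I * t * (l * T)) * F (σ + Complex.I * (l * t)))
      (𝓝[>] 0) (𝓝 (∫ t in (-1 : ℝ)..1, ((1 - |t| : ℝ) : ℂ) *
        Complex.exp (Complex.I * t * (l * T)) * F (Complex.I * (l * t)))) := by
    have hmem : ∀ᶠ σ : ℝ in 𝓝[>] 0, σ ∈ Set.Ioc (0 : ℝ) 1 := Ioc_mem_nhdsGT one_pos
    have hE : ∀ t : ℝ, ‖Complex.exp (Complex.I * t * (l * T))‖ = 1 := fun t => by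
      rw [show Complex.I * t * (l * T) = ((t * (l * T) : ℝ) : ℂ) * Complex.I by
        push_cast; ring, Complex.norm_exp_ofReal_mul_I]
    refine intervalIntegral.tendsto_integral_filter_of_dominated_convergence (fun _ => M) ?_ ?_
      intervalIntegrable_const ?_
    · filter_upwards [hmem] with σ hσ
      rw [Set.uIoc_of_le (by norm_num)]
      refine ContinuousOn.aestronglyMeasurable (ContinuousOn.mul (by fun_prop) ?_)
        measurableSet_Ioc
      refine hcont.comp (Continuous.continuousOn (by fun_prop)) fun z hz => ?_
      simpa using hσ.1.le
    · filter_upwards [hmem] with σ hσ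
      refine ae_of_all _ fun t ht => ?_
      rw [Set.uIoc_of_le (by norm_num)] at ht
      have h1 : |t| ≤ 1 := abs_le.2 ⟨ht.1.le, ht.2⟩
      rw [norm_mul, norm_mul, hE, mul_one, Complex.norm_real,
        Real.norm_of_nonneg (by linarith)]
      exact (mul_le_of_le_one_left (norm_nonneg _) (by linarith [abs_nonneg t])).trans
        (hM (σ, t) ⟨⟨hσ.1.le, hσ.2⟩, ht.1.le, ht.2⟩)
    · refine ae_of_all _ fun t _ => Tendsto.const_mul _ ?_
      have h1 : ContinuousWithinAt F {s | 0 ≤ s.re} (Complex.I * (l * t)) :=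
        hcont _ (by simp)
      refine h1.tendsto.comp (tendsto_nhdsWithin_iff.2 ⟨?_, ?_⟩)
      · have : Tendsto (fun σ : ℝ => (σ : ℂ) + Complex.I * (l * t)) (𝓝 0)
          (𝓝 ((0 : ℝ) + Complex.I * (l * t))) := Continuous.tendsto (by fun_prop) 0
        simp only [Complex.ofReal_zero, zero_add] at this
        exact this.mono_left nhdsWithin_le_nhds
      · filter_upwards [hmem] with σ hσ
        simpa using hσ.1.le
  refine tendsto_nhds_unique hlim1 (hlim2.congr' ?_)
  filter_upwards [self_mem_nhdsWithin] with σ hσ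
  exact (integral_mul_exp_mul_fejer ha hC h0 hF hσ l T).symm

/-- If the Laplace transform of a bounded function extends continuously to the imaginary axis,
then its Fejér means tend to `0`. -/
lemma tendsto_integral_mul_fejer (ha : Measurable a) (hC : ∀ u, |a u| ≤ C)
    (h0 : ∀ u ≤ 0, a u = 0) (hcont : ContinuousOn F {s | 0 ≤ s.re})
    (hF : ∀ s : ℂ, 0 < s.re → F s = ∫ u, (a u : ℂ) * Complex.exp (-s * u))
    {l : ℝ} (hl : 0 < l) :
    Tendsto (fun T => ∫ u, a u * fejer (l * (T - u))) atTop (𝓝 0) := by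
  have hRL := Real.tendsto_integral_exp_smul_cocompact ((Set.Ioc (-1 : ℝ) 1).indicator
    fun t : ℝ => ((1 - |t| : ℝ) : ℂ) * F (Complex.I * (l * t)))
  -- The Riemann–Lebesgue lemma is stated with the character e^{-2πitw}; this w turns it into
  -- e^{itlT}.
  have hw : Tendsto (fun T : ℝ => -(l * T) / (2 * Real.pi)) atTop (cocompact ℝ) := by
    refine Tendsto.mono_right ?_ atBot_le_cocompact
    exact (tendsto_neg_atTop_atBot.comp (tendsto_id.const_mul_atTop hl)).atBot_div_const (by positivity)
  have h := hRL.comp hw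
  have h2 : Tendsto (fun T => ((∫ u, a u * fejer (l * (T - u)) : ℝ) : ℂ)) atTop (𝓝 0) := by
    refine h.congr fun T => ?_
    rw [integral_mul_fejer ha hC h0 hcont hF hl.ne', intervalIntegral.integral_of_le (by norm_num),
      ← integral_indicator measurableSet_Ioc]
    refine integral_congr_ae (ae_of_all _ fun t => ?_)
    by_cases ht : t ∈ Set.Ioc (-1 : ℝ) 1
    · simp only [Set.indicator_of_mem ht]
      have hE : ((2 * Real.pi * (-(t * (-(l * T) / (2 * Real.pi)))) : ℝ) : ℂ) * Complex.I =
          Complex.I * t * (l * T) := by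
        rw [show 2 * Real.pi * (-(t * (-(l * T) / (2 * Real.pi)))) = t * (l * T) by field_simp]
        push_cast
        ring
      rw [Circle.smul_def, Real.fourierChar_apply, smul_eq_mul, hE]
      ring
    · simp only [Set.indicator_of_notMem ht, smul_zero]
  have h3 := (Complex.continuous_re.tendsto 0).comp h2
  simpa [Function.comp_def] using h3

/-- If `a` were at least η on the whole window and at least -C elsewhere, its Fejér mean at T would
exceed a fixed positive amount, against convergence to 0. -/
lemma eventually_exists_lt (ha : Measurable a) (hC : ∀ u, |a u| ≤ C)
    (h0 : ∀ u ≤ 0, a u = 0) (hcont : ContinuousOn F {s | 0 ≤ s.re})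
    (hF : ∀ s : ℂ, 0 < s.re → F s = ∫ u, (a u : ℂ) * Complex.exp (-s * u))
    {η δ : ℝ} (hη : 0 < η) (hδ : 0 < δ) :
    ∀ᶠ T in atTop, ∃ u ∈ Set.Icc (T - δ) (T + δ), a u < η := by
  have hC0 : 0 ≤ C := (abs_nonneg _).trans (hC 0)
  set I := ∫ x, fejer x with hI
  have hIpos : 0 < I := integral_fejer_pos
  have hR : Tendsto (fun R : ℝ => -C * I + (η + C) * ∫ x in (-R)..R, fejer x) atTop
      (𝓝 (-C * I + (η + C) * I)) :=
    ((intervalIntegral_tendsto_integral integrable_fejer tendsto_neg_atTop_atBot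
      tendsto_id).const_mul _).const_add _
  -- The lower bound tends to ηI as R → ∞, so some R keeps more than half of it. The scale R / δ
  -- below carries the window of radius δ onto [-R, R].
  obtain ⟨R, hR1, hR2⟩ := ((hR.eventually (lt_mem_nhds (show η * I / 2 < _ by
    nlinarith [mul_pos hη hIpos]))).and (eventually_gt_atTop 0)).exists
  have hl : 0 < R / δ := by positivity
  have hev := (tendsto_integral_mul_fejer ha hC h0 hcont hF hl).eventually
    (gt_mem_nhds (show 0 < (R / δ)⁻¹ * (η * I / 2) by positivity))
  filter_upwards [hev] with T hT
  by_contra! hcon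
  refine absurd hT (not_lt.2 ?_)
  have hfi := integrable_fejer_comp hl.ne' T
  have hlow : ∀ u, -C * fejer (R / δ * (T - u)) + (η + C) *
      (Set.Ioc (T - δ) (T + δ)).indicator (fun u => fejer (R / δ * (T - u))) u ≤
      a u * fejer (R / δ * (T - u)) := by
    intro u
    have hf := fejer_nonneg (R / δ * (T - u))
    by_cases hu : u ∈ Set.Ioc (T - δ) (T + δ)
    · rw [Set.indicator_of_mem hu]
      have := hcon u ⟨hu.1.le, hu.2⟩
      nlinarith
    · rw [Set.indicator_of_notMem hu]
      have := (abs_le.1 (hC u)).1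
      nlinarith
  have hai : Integrable fun u => a u * fejer (R / δ * (T - u)) :=
    hfi.bdd_mul ha.aestronglyMeasurable (ae_of_all _ hC)
  have hind := hfi.indicator (measurableSet_Ioc (a := T - δ) (b := T + δ))
  have hmono := integral_mono ((hfi.const_mul (-C)).add (hind.const_mul (η + C))) hai hlow
  refine le_trans ?_ hmono
  simp only [Pi.add_apply]
  rw [integral_add (hfi.const_mul (-C)) (hind.const_mul (η + C)), integral_const_mul,
    integral_const_mul, integral_indicator measurableSet_Ioc,
    ← intervalIntegral.integral_of_le (by linarith)]
  have e1 : ∫ u, fejer (R / δ * (T - u)) = (R / δ)⁻¹ * I := by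
    rw [integral_sub_left_eq_self (fun x => fejer (R / δ * x)) volume T,
      Measure.integral_comp_mul_left, abs_of_pos (by positivity), smul_eq_mul]
  have e2 : ∫ u in (T - δ)..(T + δ), fejer (R / δ * (T - u)) =
      (R / δ)⁻¹ * ∫ x in (-R)..R, fejer x := by
    rw [intervalIntegral.integral_comp_sub_left (fun x => fejer (R / δ * x)) T,
      intervalIntegral.integral_comp_mul_left _ hl.ne', smul_eq_mul]
    congr 2 <;> field_simp <;> ring
  rw [e1, e2]
  calc _ ≤ (R / δ)⁻¹ * (-C * I + (η + C) * ∫ x in (-R)..R, fejer x) := by gcongr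
    _ = _ := by ring

/-- A Tauberian theorem: if `e^u (1 + a u)` is nonnegative and nondecreasing and the Laplace
transform of the bounded function `a` extends continuously to the imaginary axis, then `a`
tends to `0`. -/
theorem tendsto_zero_of_laplace (ha : Measurable a) (hC : ∀ u, |a u| ≤ C)
    (h0 : ∀ u ≤ 0, a u = 0) (hcont : ContinuousOn F {s | 0 ≤ s.re})
    (hF : ∀ s : ℂ, 0 < s.re → F s = ∫ u, (a u : ℂ) * Complex.exp (-s * u))
    (hmono : ∀ u v, 0 < u → u ≤ v → Real.exp u * (1 + a u) ≤ Real.exp v * (1 + a v)) :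
    Tendsto a atTop (𝓝 0) := by
  have hneg : ∀ {η δ : ℝ}, 0 < η → 0 < δ →
      ∀ᶠ T in atTop, ∃ u ∈ Set.Icc (T - δ) (T + δ), -a u < η := fun hη hδ =>
    eventually_exists_lt (a := fun u => -a u) (F := fun s => -F s) ha.neg
      (fun u => by simpa using hC u) (fun u hu => by simp [h0 u hu]) hcont.neg
      (fun s hs => by simp [hF s hs, integral_neg]) hη hδ
  rw [Metric.tendsto_atTop']
  have hlim : Tendsto (fun η : ℝ => Real.exp (2 * η) * (1 + η)) (𝓝[>] 0) (𝓝 1) := by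
    have : Tendsto (fun η : ℝ => Real.exp (2 * η) * (1 + η)) (𝓝 0)
      (𝓝 (Real.exp (2 * 0) * (1 + 0))) := Continuous.tendsto (by fun_prop) 0
    simp only [mul_zero, Real.exp_zero, add_zero, mul_one] at this
    exact this.mono_left nhdsWithin_le_nhds
  have hlim' : Tendsto (fun η : ℝ => Real.exp (-(2 * η)) * (1 - η)) (𝓝[>] 0) (𝓝 1) := by
    have : Tendsto (fun η : ℝ => Real.exp (-(2 * η)) * (1 - η)) (𝓝 0)
      (𝓝 (Real.exp (-(2 * 0)) * (1 - 0))) := Continuous.tendsto (by fun_prop) 0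
    simp only [mul_zero, neg_zero, Real.exp_zero, sub_zero, mul_one] at this
    exact this.mono_left nhdsWithin_le_nhds
  intro ε hε
  obtain ⟨η, ⟨⟨h1, h2⟩, h4⟩, h3⟩ := (((hlim.eventually (gt_mem_nhds (show (1 : ℝ) < 1 + ε by linarith))).and
    (hlim'.eventually (lt_mem_nhds (show 1 - ε < (1 : ℝ) by linarith)))).and
      (hlim'.eventually (lt_mem_nhds (show 0 < (1 : ℝ) by linarith)))).and
      self_mem_nhdsWithin |>.exists
  have hη : 0 < η := h3
  have hη1 : 0 < 1 - η := pos_of_mul_pos_right h4 (Real.exp_pos _).le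
  have hA := eventually_exists_lt ha hC h0 hcont hF hη hη
  have hB := hneg hη hη
  -- Centring the windows at T + η and T - η places u in [T, T + 2η] and v in [T - 2η, T].
  -- Monotonicity then compares both with T, at the cost of a factor e^{±2η}.
  have hA' := (tendsto_atTop_add_const_right atTop η tendsto_id).eventually hA
  have hB' := (tendsto_atTop_add_const_right atTop (-η) tendsto_id).eventually hB
  obtain ⟨N, hN⟩ := eventually_atTop.1 (hA'.and (hB'.and (eventually_gt_atTop (2 * η))))
  refine ⟨N, fun T hT => ?_⟩
  obtain ⟨⟨u, hu, hau⟩, ⟨v, hv, hav⟩, hT2⟩ := hN T hT.le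
  simp only [id, Set.mem_Icc] at hu hv
  rw [Real.dist_eq, sub_zero, abs_lt]
  constructor
  · have hm := hmono v T (by linarith) (by linarith)
    have : Real.exp (-(2 * η)) * (1 - η) ≤ 1 + a T := by
      have h5 : Real.exp T * (Real.exp (-(2 * η)) * (1 - η)) ≤ Real.exp T * (1 + a T) := by
        refine le_trans ?_ hm
        rw [← mul_assoc, ← Real.exp_add]
        exact mul_le_mul (Real.exp_le_exp.2 (by linarith)) (by linarith) hη1.le (Real.exp_pos _).le
      exact le_of_mul_le_mul_left h5 (Real.exp_pos _)
    linarith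
  · have hm := hmono T u (by linarith) (by linarith)
    have : 1 + a T ≤ Real.exp (2 * η) * (1 + η) := by
      have h5 : Real.exp T * (1 + a T) ≤ Real.exp T * (Real.exp (2 * η) * (1 + η)) := by
        refine hm.trans ?_
        rw [← mul_assoc, ← Real.exp_add]
        refine (mul_le_mul_of_nonneg_left (show 1 + a u ≤ 1 + η by linarith)
          (Real.exp_pos _).le).trans ?_
        exact mul_le_mul_of_nonneg_right (Real.exp_le_exp.2 (by linarith)) (by linarith)
      exact le_of_mul_le_mul_left h5 (Real.exp_pos _)
    linarith

end

/-! ### The prime number theorem -/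

open ArithmeticFunction in
-- Modulo 1 there is a single residue class, so the continuation result for primes in progressions
-- specialises to -ζ'/ζ.
lemma residueClass_one_eq (n : ℕ) : vonMangoldt.residueClass (1 : ZMod 1) n = vonMangoldt n := by
  unfold vonMangoldt.residueClass
  simp only [Set.indicator_apply, Set.mem_ofPred_eq, Subsingleton.elim (n : ZMod 1) 1, if_true]

/-- The Laplace transform of `ψ(e^u) e^{-u} - 1`, continued to the closed right half plane. -/
noncomputable def psiLaplace (s : ℂ) : ℂ :=
  (ArithmeticFunction.vonMangoldt.LFunctionResidueClassAux (1 : ZMod 1) (1 + s) - 1) / (1 + s)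

lemma continuousOn_psiLaplace : ContinuousOn psiLaplace {s | 0 ≤ s.re} := by
  unfold psiLaplace
  refine ContinuousOn.div (ContinuousOn.sub ?_ continuousOn_const) (by fun_prop) fun s hs h => ?_
  · refine (ArithmeticFunction.vonMangoldt.continuousOn_LFunctionResidueClassAux
      (1 : ZMod 1)).comp (by fun_prop) fun s hs => ?_
    have : 0 ≤ s.re := hs
    simpa using this
  · have h1 : 0 ≤ s.re := hs
    have := congrArg Complex.re h
    simp at this
    linarith

lemma psi_exp_mul_exp_neg_le {u : ℝ} :
    Chebyshev.psi (Real.exp u) * Real.exp (-u) ≤ Real.log 4 + 4 := by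
  rw [Real.exp_neg, ← div_eq_mul_inv, div_le_iff₀ (Real.exp_pos _)]
  exact Chebyshev.psi_le_const_mul_self (Real.exp_pos _).le

lemma integrableOn_psi_exp {s : ℂ} (hs : 0 < s.re) :
    IntegrableOn (fun u : ℝ => ((Chebyshev.psi (Real.exp u) * Real.exp (-u) : ℝ) : ℂ) *
      Complex.exp (-s * u)) (Set.Ioi 0) := by
  have hm := Chebyshev.psi_mono.measurable
  refine Integrable.mono' (g := fun u => (Real.log 4 + 4) * Real.exp (-s.re * u))
    ((exp_neg_integrableOn_Ioi 0 hs).const_mul _) (Measurable.aestronglyMeasurable (by fun_prop))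
    (ae_of_all _ fun u => ?_)
  rw [norm_mul, Complex.norm_exp, Complex.norm_real, Real.norm_of_nonneg
    (mul_nonneg (Chebyshev.psi_nonneg _) (Real.exp_pos _).le)]
  have : (-s * u).re = -s.re * u := by simp
  rw [this]
  exact mul_le_mul_of_nonneg_right psi_exp_mul_exp_neg_le (Real.exp_pos _).le

/-- Abel summation, followed by the substitution t = e^u. -/
lemma LSeries_vonMangoldt_eq_integral {s : ℂ} (hs : 0 < s.re) :
    LSeries (fun n => (ArithmeticFunction.vonMangoldt n : ℂ)) (1 + s) = (1 + s) *
      ∫ u in Set.Ioi (0 : ℝ), ((Chebyshev.psi (Real.exp u) * Real.exp (-u) : ℝ) : ℂ) *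
        Complex.exp (-s * u) := by
  have hsum : ∀ t : ℝ, ∑ k ∈ Finset.Icc 1 ⌊t⌋₊, ArithmeticFunction.vonMangoldt k =
      Chebyshev.psi t := fun t => by
    rw [Chebyshev.psi, ← Finset.Icc_add_one_left_eq_Ioc, zero_add]
  have hO : (fun n : ℕ => ∑ k ∈ Finset.Icc 1 n, ArithmeticFunction.vonMangoldt k) =O[atTop]
      fun n : ℕ => (n : ℝ) ^ (1 : ℝ) := by
    refine IsBigO.of_bound (Real.log 4 + 4) (Eventually.of_forall fun n => ?_)
    have h := hsum n
    rw [Nat.floor_natCast] at h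
    rw [h, Real.rpow_one, Real.norm_of_nonneg (Chebyshev.psi_nonneg _), Real.norm_natCast]
    exact Chebyshev.psi_le_const_mul_self (Nat.cast_nonneg n)
  rw [LSeries_eq_mul_integral_of_nonneg _ zero_le_one (s := 1 + s) (by simpa using hs) hO
    fun n => ArithmeticFunction.vonMangoldt_nonneg]
  congr 1
  have himg : Real.exp '' Set.Ioi 0 = Set.Ioi 1 := by
    rw [Real.image_exp_Ioi, Real.exp_zero]
  rw [← himg, integral_image_eq_integral_abs_deriv_smul measurableSet_Ioi
    (fun u _ => (Real.hasDerivAt_exp u).hasDerivWithinAt) Real.exp_injective.injOn]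
  refine setIntegral_congr_fun measurableSet_Ioi fun u _ => ?_
  rw [abs_of_pos (Real.exp_pos _), ← Complex.ofReal_sum, hsum, Complex.real_smul,
    Complex.cpow_def_of_ne_zero (Complex.ofReal_ne_zero.2 (Real.exp_pos u).ne'),
    ← Complex.ofReal_log (Real.exp_pos u).le, Real.log_exp]
  have : Complex.exp (u * -(1 + s + 1)) =
      Complex.exp (-u) * Complex.exp (-u) * Complex.exp (-s * u) := by
    rw [← Complex.exp_add, ← Complex.exp_add]
    ring_nf
  rw [this]
  have h1 : Complex.exp u * Complex.exp (-u) = 1 := by rw [← Complex.exp_add]; simp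
  push_cast
  linear_combination (Chebyshev.psi (Real.exp u) * Complex.exp (-u) * Complex.exp (-s * u)) * h1

/-- With L the Dirichlet series of Λ at 1 + s and A = L - 1/s, the pole cancels: L/(1 + s) - 1/s =
(A - 1)/(1 + s). -/
lemma psiLaplace_eq {s : ℂ} (hs : 0 < s.re) : psiLaplace s =
    ∫ u in Set.Ioi (0 : ℝ), ((Chebyshev.psi (Real.exp u) * Real.exp (-u) - 1 : ℝ) : ℂ) *
        Complex.exp (-s * u) := by
  have hs0 : s ≠ 0 := fun h => by simp [h] at hs
  have hs1 : 1 + s ≠ 0 := fun h => by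
    have := congrArg Complex.re h
    simp at this
    linarith
  have hA := ArithmeticFunction.vonMangoldt.eqOn_LFunctionResidueClassAux (a := (1 : ZMod 1))
    isUnit_one (show 1 + s ∈ {s : ℂ | 1 < s.re} by simpa using hs)
  simp only [residueClass_one_eq, Nat.totient_one, Nat.cast_one, inv_one, add_sub_cancel_left] at hA
  rw [psiLaplace, hA, LSeries_vonMangoldt_eq_integral hs]
  have hexp : ∫ u in Set.Ioi (0 : ℝ), Complex.exp (-s * u) = 1 / s := by
    rw [integral_exp_mul_complex_Ioi (by simpa using hs)]
    simp
  have hint : IntegrableOn (fun u : ℝ => Complex.exp (-s * u)) (Set.Ioi 0) :=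
    integrableOn_exp_mul_complex_Ioi (by simpa using hs) 0
  have hsub : ∀ u : ℝ, ((Chebyshev.psi (Real.exp u) * Real.exp (-u) - 1 : ℝ) : ℂ) *
      Complex.exp (-s * u) = ((Chebyshev.psi (Real.exp u) * Real.exp (-u) : ℝ) : ℂ) *
        Complex.exp (-s * u) - Complex.exp (-s * u) := by
    intro u
    push_cast
    ring
  simp_rw [hsub]
  rw [integral_sub (integrableOn_psi_exp hs) hint, hexp]
  field_simp
  ring

/-- The prime number theorem for the Chebyshev function `ψ`. -/
theorem tendsto_psi_div : Tendsto (fun x => Chebyshev.psi x / x) atTop (𝓝 1) := by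
  have hm := Chebyshev.psi_mono.measurable
  have h4 : 0 ≤ Real.log 4 := Real.log_nonneg (by norm_num)
  -- For u > 0 this choice gives e^u (1 + a(u)) = ψ(e^u), which is monotone. The indicator enforces
  -- the required vanishing for u ≤ 0.
  have h := tendsto_zero_of_laplace (F := psiLaplace) (C := Real.log 4 + 4)
    (a := (Set.Ioi (0 : ℝ)).indicator fun u => Chebyshev.psi (Real.exp u) * Real.exp (-u) - 1)
    (Measurable.indicator (by fun_prop) measurableSet_Ioi) (fun u => ?_) (fun u hu => ?_)
    continuousOn_psiLaplace (fun s hs => ?_) (fun u v hu huv => ?_)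
  · have h1 : Tendsto (fun u : ℝ => Chebyshev.psi (Real.exp u) * Real.exp (-u)) atTop (𝓝 1) := by
      have h2 := h.add_const 1
      rw [zero_add] at h2
      refine h2.congr' ?_
      filter_upwards [eventually_gt_atTop 0] with u hu
      rw [Set.indicator_of_mem (Set.mem_Ioi.2 hu)]
      ring
    refine (h1.comp Real.tendsto_log_atTop).congr' ?_
    filter_upwards [eventually_gt_atTop 0] with x hx
    simp only [Function.comp]
    rw [Real.exp_neg, Real.exp_log hx, div_eq_mul_inv]
  · by_cases hu : u ∈ Set.Ioi (0 : ℝ)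
    · rw [Set.indicator_of_mem hu, abs_le]
      have h1 := psi_exp_mul_exp_neg_le (u := u)
      have h2 : 0 ≤ Chebyshev.psi (Real.exp u) * Real.exp (-u) :=
        mul_nonneg (Chebyshev.psi_nonneg _) (Real.exp_pos _).le
      constructor <;> linarith
    · rw [Set.indicator_of_notMem hu, abs_zero]
      linarith
  · exact Set.indicator_of_notMem (by simpa using hu) _
  · rw [psiLaplace_eq hs, ← integral_indicator measurableSet_Ioi]
    refine integral_congr_ae (ae_of_all _ fun u => ?_)
    by_cases hu : u ∈ Set.Ioi (0 : ℝ)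
    · simp only [Set.indicator_of_mem hu]
    · simp only [Set.indicator_of_notMem hu, Complex.ofReal_zero, zero_mul]
  · have hpsi : ∀ w : ℝ, 0 < w → Real.exp w * (1 + (Set.Ioi (0 : ℝ)).indicator
        (fun u => Chebyshev.psi (Real.exp u) * Real.exp (-u) - 1) w) =
          Chebyshev.psi (Real.exp w) := by
      intro w hw
      rw [Set.indicator_of_mem (by exact hw), Real.exp_neg]
      field_simp
      ring
    rw [hpsi u hu, hpsi v (hu.trans_le huv)]
    exact Chebyshev.psi_mono (Real.exp_le_exp.2 huv)

/-- Proper prime powers contribute only O(√x) to ψ. -/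
theorem tendsto_theta_div : Tendsto (fun x => Chebyshev.theta x / x) atTop (𝓝 1) := by
  have h : (fun x => Chebyshev.psi x - Chebyshev.theta x) =o[atTop] fun x : ℝ => x := by
    refine Chebyshev.isBigO_psi_sub_theta_sqrt.trans_isLittleO ?_
    refine isLittleO_of_tendsto' ?_ ?_
    · filter_upwards [eventually_gt_atTop 0] with x hx h
      exact absurd h hx.ne'
    · refine (tendsto_inv_atTop_zero.comp Real.tendsto_sqrt_atTop).congr fun x => ?_
      rw [Function.comp, Real.sqrt_div_self]
  have h2 := tendsto_psi_div.sub h.tendsto_div_nhds_zero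
  rw [sub_zero] at h2
  refine h2.congr fun x => ?_
  ring

/-! ### Comparison of π and li with x / log x -/

lemma isLittleO_div_log_sq :
    (fun x : ℝ => x / Real.log x ^ 2) =o[atTop] fun x => x / Real.log x := by
  refine isLittleO_of_tendsto' ?_ ?_
  · filter_upwards [eventually_gt_atTop 1] with x hx h
    have := Real.log_pos hx
    have : x / Real.log x ≠ 0 := by positivity
    contradiction
  · refine (tendsto_inv_atTop_zero.comp Real.tendsto_log_atTop).congr' ?_
    filter_upwards [eventually_gt_atTop 1] with x hx
    have := Real.log_pos hx
    simp only [Function.comp]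
    field_simp

/-- The prime number theorem. -/
theorem primePi_isEquivalent :
    (fun x : ℝ => (primePi x : ℝ)) ~[atTop] fun x => x / Real.log x := by
  have h1 : (fun x : ℝ => (primePi x : ℝ) - Chebyshev.theta x / Real.log x) =o[atTop]
      fun x => x / Real.log x :=
    Chebyshev.primeCounting_sub_theta_div_log_isBigO.trans_isLittleO isLittleO_div_log_sq
  have h2 : (fun x : ℝ => Chebyshev.theta x) ~[atTop] fun x => x :=
    (isEquivalent_iff_tendsto_one (eventually_ne_atTop 0)).2 tendsto_theta_div
  have h3 := h2.div (IsEquivalent.refl (u := Real.log))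
  exact h3.add_isLittleO h1 |>.congr_left (Eventually.of_forall fun x => by simp)

lemma tendsto_div_log_atTop : Tendsto (fun x => x / Real.log x) atTop atTop := by
  have h := Real.isLittleO_log_id_atTop.tendsto_div_nhds_zero
  have h2 : Tendsto (fun x => Real.log x / x) atTop (𝓝[>] 0) := by
    refine tendsto_nhdsWithin_iff.2 ⟨h, ?_⟩
    filter_upwards [eventually_gt_atTop 1] with x hx
    exact div_pos (Real.log_pos hx) (by linarith)
  exact h2.inv_tendsto_nhdsGT_zero.congr fun x => inv_div _ _

/-- The derivative of t / log t is 1 / log t - 1 / log² t, and the integral of 1 / log² t is O(x /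
log² x). -/
lemma li_isEquivalent : li ~[atTop] fun x => x / Real.log x := by
  have h1 : (fun x => (∫ t in (2 : ℝ)..x, 1 / Real.log t ^ 2) - 2 / Real.log 2) =o[atTop]
      fun x => x / Real.log x := by
    refine (Chebyshev.integral_one_div_log_sq_isBigO.trans_isLittleO isLittleO_div_log_sq).sub
      (isLittleO_const_left.2 (Or.inr (tendsto_norm_atTop_atTop.comp tendsto_div_log_atTop)))
  refine (IsEquivalent.refl.add_isLittleO h1).congr_left ?_
  filter_upwards [eventually_ge_atTop 2] with x hx
  have hsub : Set.uIcc 2 x ⊆ Set.Ici 2 := by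
    rw [Set.uIcc_of_le hx]
    exact Set.Icc_subset_Ici_self
  have hlog : ∀ t ∈ Set.uIcc 2 x, Real.log t ≠ 0 := fun t ht =>
    (Real.log_pos (by have : 2 ≤ t := hsub ht; linarith)).ne'
  have ht0 : ∀ t ∈ Set.uIcc 2 x, t ≠ 0 := fun t ht => by
    have : 2 ≤ t := hsub ht
    linarith
  have hi1 : IntervalIntegrable (fun t => 1 / Real.log t) volume 2 x :=
    ContinuousOn.intervalIntegrable (continuousOn_const.div (Real.continuousOn_log.mono
      fun t ht => ht0 t ht) hlog)
  have hi2 : IntervalIntegrable (fun t => 1 / Real.log t ^ 2) volume 2 x :=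
    Chebyshev.intervalIntegrable_one_div_log_sq (by norm_num) (by linarith)
  have hFTC : ∫ t in (2 : ℝ)..x, (1 / Real.log t - 1 / Real.log t ^ 2) =
      x / Real.log x - 2 / Real.log 2 := by
    refine intervalIntegral.integral_eq_sub_of_hasDerivAt (f := fun t => t / Real.log t)
      (fun t ht => ?_) (hi1.sub hi2)
    refine ((hasDerivAt_id t).div (Real.hasDerivAt_log (ht0 t ht)) (hlog t ht)).congr_deriv ?_
    have := hlog t ht
    have := ht0 t ht
    simp only [id]
    field_simp
  rw [intervalIntegral.integral_sub hi1 hi2] at hFTC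
  simp only [Pi.add_apply, li]
  linarith

/-! ### Mertens' first and second theorems -/

lemma log_factorial_eq_sum (N : ℕ) : Real.log (N.factorial : ℝ) =
    ∑ q ∈ Nat.primesLE N, (padicValNat q N.factorial : ℝ) * Real.log q := by
  rw [Real.log_nat_eq_sum_factorization, Finsupp.sum_of_support_subset]
  · refine Finset.sum_congr rfl fun q hq => ?_
    rw [Nat.factorization_def _ (Nat.prime_of_mem_primesLE hq)]
  · intro q hq
    rw [Nat.support_factorization, Nat.mem_primeFactors] at hq
    exact Nat.mem_primesLE.2 ⟨(hq.1.dvd_factorial).1 hq.2.1, hq.1⟩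
  · simp

lemma le_padicValNat_factorial {q : ℕ} (hq : q.Prime) (N : ℕ) :
    (N : ℝ) / q - 1 ≤ padicValNat q N.factorial := by
  have := Fact.mk hq
  have h : N / q ≤ padicValNat q N.factorial := by
    rw [padicValNat_factorial (b := Nat.log q N + 2) (by omega)]
    refine le_trans (by simp) (Finset.single_le_sum (f := fun i => N / q ^ i)
      (fun i _ => Nat.zero_le _) (Finset.mem_Ico.2 ⟨le_refl 1, by omega⟩))
  have h2 := (Nat.sub_one_lt_floor ((N : ℝ) / q)).le
  rw [Nat.floor_div_eq_div] at h2
  exact h2.trans (Nat.cast_le.2 h)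

/-- By Legendre, (q - 1) times the exponent of q in N! is N minus the base-q digit sum. -/
lemma padicValNat_factorial_le {q : ℕ} (hq : q.Prime) (N : ℕ) :
    (padicValNat q N.factorial : ℝ) ≤ N / (q - 1) := by
  have := Fact.mk hq
  have h2 : (1 : ℝ) < q := by exact_mod_cast hq.one_lt
  rw [le_div_iff₀ (by linarith), mul_comm]
  have h := sub_one_mul_padicValNat_factorial (p := q) N
  have h3 : (q - 1) * padicValNat q N.factorial ≤ N := by omega
  have h4 : (((q - 1 : ℕ) : ℝ)) * padicValNat q N.factorial ≤ N := by exact_mod_cast h3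
  rwa [Nat.cast_sub hq.one_lt.le, Nat.cast_one] at h4

/-- Chebyshev's device: N! ≤ N^N bounds the sum from above, and the rounding errors total at most
θ(N) ≤ N log 4. -/
lemma sum_primesLE_log_div_le (N : ℕ) (hN : N ≠ 0) :
    ∑ q ∈ Nat.primesLE N, Real.log q / q ≤ Real.log N + Real.log 4 := by
  have hN0 : (0 : ℝ) < N := by exact_mod_cast Nat.pos_of_ne_zero hN
  have h1 : ∑ q ∈ Nat.primesLE N, ((N : ℝ) / q - 1) * Real.log q ≤ Real.log (N.factorial : ℝ) := by
    rw [log_factorial_eq_sum]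
    refine Finset.sum_le_sum fun q hq => ?_
    exact mul_le_mul_of_nonneg_right (le_padicValNat_factorial (Nat.prime_of_mem_primesLE hq) N)
      (Real.log_natCast_nonneg q)
  have h2 : Real.log (N.factorial : ℝ) ≤ N * Real.log N := by
    rw [← Real.log_pow]
    refine Real.log_le_log (by exact_mod_cast N.factorial_pos) ?_
    exact_mod_cast N.factorial_le_pow
  have h3 : ∑ q ∈ Nat.primesLE N, ((N : ℝ) / q - 1) * Real.log q =
      N * ∑ q ∈ Nat.primesLE N, Real.log q / q - Chebyshev.theta N := by
    rw [Chebyshev.theta_eq_sum_primesLE_log, Finset.mul_sum, ← Finset.sum_sub_distrib]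
    exact Finset.sum_congr rfl fun q _ => by ring
  have h4 := Chebyshev.theta_le_log4_mul_x hN0.le
  refine le_of_mul_le_mul_left ?_ hN0
  linarith

/-- From log q ≤ 2q^{1/2} and q - 1 ≥ q/2. The majorant is summable over all integers. -/
lemma log_div_mul_sub_one_le {q : ℕ} (hq : 2 ≤ q) :
    Real.log q / (q * (q - 1)) ≤ 4 * ((q : ℝ) ^ (3 / 2 : ℝ))⁻¹ := by
  have hq' : (2 : ℝ) ≤ q := by exact_mod_cast hq
  have h := Real.log_le_rpow_div (x := q) (ε := 1 / 2) (by linarith) (by norm_num)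
  have hpos : 0 < (q : ℝ) ^ (1 / 2 : ℝ) := Real.rpow_pos_of_pos (by linarith) _
  have h32 : (q : ℝ) ^ (3 / 2 : ℝ) * (q : ℝ) ^ (1 / 2 : ℝ) = q ^ 2 := by
    rw [← Real.rpow_add (by linarith), ← Real.rpow_natCast]
    norm_num
  rw [div_le_iff₀ (mul_pos (by linarith) (by linarith)), ← div_eq_mul_inv, div_mul_eq_mul_div,
    le_div_iff₀ (Real.rpow_pos_of_pos (by linarith) _)]
  have h3pos : 0 < (q : ℝ) ^ (3 / 2 : ℝ) := Real.rpow_pos_of_pos (by linarith) _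
  calc Real.log q * (q : ℝ) ^ (3 / 2 : ℝ) ≤ (q : ℝ) ^ (1 / 2 : ℝ) / (1 / 2) * (q : ℝ) ^ (3 / 2 : ℝ) :=
        mul_le_mul_of_nonneg_right h h3pos.le
    _ = 2 * q ^ 2 := by rw [← h32]; ring
    _ ≤ _ := by nlinarith

/-- Stirling bounds log N! from below by N log N - N, while 1/(q - 1) = 1/q + 1/(q(q - 1)) splits
the upper bound for the exponents into the main sum and a convergent one. -/
lemma le_sum_primesLE_log_div :
    ∃ D : ℝ, ∀ N : ℕ, N ≠ 0 → Real.log N - D ≤ ∑ q ∈ Nat.primesLE N, Real.log q / q := by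
  have hs : Summable fun n : ℕ => 4 * ((n : ℝ) ^ (3 / 2 : ℝ))⁻¹ :=
    (Real.summable_nat_rpow_inv.2 (by norm_num)).mul_left 4
  refine ⟨1 + ∑' n : ℕ, 4 * ((n : ℝ) ^ (3 / 2 : ℝ))⁻¹, fun N hN => ?_⟩
  have hN0 : (0 : ℝ) < N := by exact_mod_cast Nat.pos_of_ne_zero hN
  have hN1 : (1 : ℝ) ≤ N := by exact_mod_cast Nat.pos_of_ne_zero hN
  have h1 : ∑ q ∈ Nat.primesLE N, Real.log q / (q * (q - 1)) ≤
      ∑' n : ℕ, 4 * ((n : ℝ) ^ (3 / 2 : ℝ))⁻¹ :=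
    (Finset.sum_le_sum fun q hq => log_div_mul_sub_one_le (Nat.two_le_of_mem_primesLE hq)).trans
      (hs.sum_le_tsum _ fun n _ => by positivity)
  have h2 : Real.log (N.factorial : ℝ) ≤ N * (∑ q ∈ Nat.primesLE N, Real.log q / q +
      ∑ q ∈ Nat.primesLE N, Real.log q / (q * (q - 1))) := by
    rw [log_factorial_eq_sum, ← Finset.sum_add_distrib, Finset.mul_sum]
    refine Finset.sum_le_sum fun q hq => ?_
    have hq2 : (2 : ℝ) ≤ q := by exact_mod_cast Nat.two_le_of_mem_primesLE hq
    have hq1 : (0 : ℝ) < q - 1 := by linarith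
    refine (mul_le_mul_of_nonneg_right (padicValNat_factorial_le (Nat.prime_of_mem_primesLE hq) N)
      (Real.log_natCast_nonneg q)).trans (le_of_eq ?_)
    field_simp
    ring
  have h3 := Stirling.le_log_factorial_stirling hN
  have h4 : 0 ≤ Real.log N / 2 := by have := Real.log_nonneg hN1; positivity
  have h5 : 0 ≤ Real.log (2 * Real.pi) / 2 := by
    have := Real.log_nonneg (show 1 ≤ 2 * Real.pi by linarith [Real.pi_gt_three])
    positivity
  refine le_of_mul_le_mul_left ?_ hN0
  nlinarith

/-- The summand `log k / k` over the primes. -/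
noncomputable def primeLogDiv (k : ℕ) : ℝ := if k.Prime then Real.log k / k else 0

/-- The reciprocals of the primes. -/
noncomputable def primeInv (k : ℕ) : ℝ := if k.Prime then 1 / (k : ℝ) else 0

/-- **Mertens' first theorem**. -/
lemma exists_abs_sum_primeLogDiv_sub_log_le :
    ∃ C : ℝ, ∀ t : ℝ, 1 ≤ t → |∑ k ∈ Finset.Icc 0 ⌊t⌋₊, primeLogDiv k - Real.log t| ≤ C := by
  obtain ⟨D, hD⟩ := le_sum_primesLE_log_div
  have hl2 := Real.log_nonneg (show (1 : ℝ) ≤ 2 by norm_num)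
  refine ⟨|D| + Real.log 2 + Real.log 4, fun t ht => ?_⟩
  have hN : ⌊t⌋₊ ≠ 0 := (Nat.floor_pos.2 ht).ne'
  have hN0 : (0 : ℝ) < ⌊t⌋₊ := by exact_mod_cast Nat.pos_of_ne_zero hN
  have hN1 : (1 : ℝ) ≤ ⌊t⌋₊ := by exact_mod_cast Nat.pos_of_ne_zero hN
  have h1 : ∑ k ∈ Finset.Icc 0 ⌊t⌋₊, primeLogDiv k =
      ∑ q ∈ Nat.primesLE ⌊t⌋₊, Real.log q / q := by
    rw [Nat.primesLE_eq_filter_Icc_zero, Finset.sum_filter]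
    rfl
  have h2 := hD _ hN
  have h3 := sum_primesLE_log_div_le _ hN
  have h4 : Real.log ⌊t⌋₊ ≤ Real.log t := Real.log_le_log hN0 (Nat.floor_le (by linarith))
  have h5 : Real.log t ≤ Real.log 2 + Real.log ⌊t⌋₊ := by
    rw [← Real.log_mul (by norm_num) hN0.ne']
    exact Real.log_le_log (by linarith) (by linarith [Nat.lt_floor_add_one t])
  have h6 := le_abs_self D
  have h7 := abs_nonneg D
  have h8 := Real.log_nonneg (show (1 : ℝ) ≤ 4 by norm_num)
  rw [h1, abs_le]
  constructor <;> linarith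

/-- **Mertens' second theorem**, with an unspecified constant. -/
lemma exists_tendsto_sum_primeInv_sub_log_log :
    ∃ β : ℝ, Tendsto (fun x : ℝ => ∑ k ∈ Finset.Icc 0 ⌊x⌋₊, primeInv k - Real.log (Real.log x))
      atTop (𝓝 β) := by
  obtain ⟨C, hC⟩ := exists_abs_sum_primeLogDiv_sub_log_le
  set R : ℝ → ℝ := fun t => ∑ k ∈ Finset.Icc 0 ⌊t⌋₊, primeLogDiv k - Real.log t with hR
  have hRm : Measurable R := by
    have : Measurable fun n : ℕ => ∑ k ∈ Finset.Icc 0 n, primeLogDiv k := measurable_from_top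
    exact (this.comp Nat.measurable_floor).sub Real.measurable_log
  have hint : IntegrableOn (fun t => t⁻¹ / Real.log t ^ 2 * R t) (Set.Ioi 2) := by
    refine Integrable.mul_bdd (c := C) (integrableOn_inv_div_log_sq_Ioi (by norm_num))
      hRm.aestronglyMeasurable ?_
    filter_upwards [ae_restrict_mem measurableSet_Ioi] with t ht
    have : (2 : ℝ) < t := ht
    exact hC t (by linarith)
  -- Abel summation with weight 1 / log t: the boundary term is (log x + R(x)) / log x, giving 1 + 0
  -- in the limit, and log log 2 is the lower endpoint of ∫ dt / (t log t).
  refine ⟨1 + 0 - Real.log (Real.log 2) + ∫ t in Set.Ioi 2, t⁻¹ / Real.log t ^ 2 * R t, ?_⟩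
  have hlim1 : Tendsto (fun x => R x / Real.log x) atTop (𝓝 0) := by
    refine squeeze_zero_norm' (a := fun x => C / Real.log x) ?_
      (tendsto_const_nhds.div_atTop Real.tendsto_log_atTop)
    filter_upwards [eventually_gt_atTop 1] with x hx
    rw [norm_div, Real.norm_of_nonneg (Real.log_pos hx).le]
    exact div_le_div_of_nonneg_right (hC x hx.le) (Real.log_pos hx).le
  have hlim2 := intervalIntegral_tendsto_integral_Ioi 2 hint tendsto_id
  refine (((hlim1.const_add 1).sub_const (Real.log (Real.log 2))).add hlim2).congr' ?_
  filter_upwards [eventually_gt_atTop 2] with x hx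
  have hlog : ∀ t ∈ Set.Icc 2 x, Real.log t ≠ 0 := fun t ht =>
    (Real.log_pos (by linarith [ht.1])).ne'
  have ht0 : ∀ t ∈ Set.Icc 2 x, t ≠ 0 := fun t ht => by linarith [ht.1]
  have hx0 : Real.log x ≠ 0 := hlog x ⟨hx.le, le_rfl⟩
  have hcd : ContinuousOn (fun t => -t⁻¹ / Real.log t ^ 2) (Set.Icc 2 x) := by
    refine ContinuousOn.div (continuousOn_id.inv₀ ht0).neg ((Real.continuousOn_log.mono
      fun t ht => ht0 t ht).pow 2) fun t ht => pow_ne_zero 2 (hlog t ht)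
  have habel := sum_mul_eq_sub_integral_mul₁ (f := fun t => (Real.log t)⁻¹) primeLogDiv
    (by simp [primeLogDiv]) (by simp [primeLogDiv, Nat.not_prime_one]) x
    (fun t ht => ((Real.hasDerivAt_log (ht0 t ht)).inv (hlog t ht)).differentiableAt)
    (by
      simp_rw [Real.deriv_inv_log]
      exact hcd.integrableOn_Icc)
  have hB : ∑ k ∈ Finset.Icc 0 ⌊x⌋₊, (Real.log k)⁻¹ * primeLogDiv k =
      ∑ k ∈ Finset.Icc 0 ⌊x⌋₊, primeInv k := by
    refine Finset.sum_congr rfl fun k _ => ?_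
    unfold primeLogDiv primeInv
    split_ifs with hk
    · have : Real.log k ≠ 0 := (Real.log_pos (by exact_mod_cast hk.one_lt)).ne'
      field_simp
    · simp
  rw [hB] at habel
  have hI : ∫ t in Set.Ioc 2 x, deriv (fun t => (Real.log t)⁻¹) t *
      ∑ k ∈ Finset.Icc 0 ⌊t⌋₊, primeLogDiv k =
      -((Real.log (Real.log x) - Real.log (Real.log 2)) +
        ∫ t in (2 : ℝ)..x, t⁻¹ / Real.log t ^ 2 * R t) := by
    rw [← integral_inv_div_log (by norm_num) (by linarith), ← intervalIntegral.integral_of_le hx.le,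
      ← intervalIntegral.integral_add, ← intervalIntegral.integral_neg]
    · refine intervalIntegral.integral_congr fun t ht => ?_
      rw [Set.uIcc_of_le hx.le] at ht
      have h1 := hlog t ht
      have h2 := ht0 t ht
      simp only [Real.deriv_inv_log, hR]
      field_simp
      ring
    · refine ContinuousOn.intervalIntegrable ?_
      rw [Set.uIcc_of_le hx.le]
      exact (continuousOn_id.inv₀ ht0).div (Real.continuousOn_log.mono fun t ht => ht0 t ht) hlog
    · rw [intervalIntegrable_iff_integrableOn_Ioc_of_le hx.le]
      exact hint.mono_set Set.Ioc_subset_Ioi_self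
  rw [hI] at habel
  rw [habel]
  simp only [id, hR]
  field_simp
  ring

/-! ### Mertens' third theorem -/

/-- The bound |log v| ≤ v + 2v^{-1/2} reduces this to the integrals for Γ(2) and Γ(1/2). -/
lemma integrableOn_log_mul_exp_neg :
    IntegrableOn (fun v => |Real.log v| * Real.exp (-v)) (Set.Ioi 0) := by
  have h2 := Real.GammaIntegral_convergent (s := 2) (by norm_num)
  have h1 := Real.GammaIntegral_convergent (s := 1 / 2) (by norm_num)
  refine Integrable.mono' (h2.add (h1.const_mul 2))
    (Measurable.aestronglyMeasurable (by fun_prop)) ?_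
  filter_upwards [ae_restrict_mem measurableSet_Ioi] with v hv
  have hv0 : 0 < v := hv
  simp only [Pi.add_apply]
  rw [Real.norm_of_nonneg (mul_nonneg (abs_nonneg _) (Real.exp_pos _).le),
    show (2 : ℝ) - 1 = 1 by norm_num, Real.rpow_one, show (1 / 2 : ℝ) - 1 = -(1 / 2) by norm_num]
  have hpos : 0 < v ^ (-(1 / 2) : ℝ) := Real.rpow_pos_of_pos hv0 _
  have hle : |Real.log v| ≤ v + 2 * v ^ (-(1 / 2) : ℝ) := by
    rw [abs_le]
    constructor
    · have := Real.log_le_rpow_div (x := v⁻¹) (ε := 1 / 2) (by positivity) (by norm_num)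
      rw [Real.log_inv, Real.inv_rpow hv0.le, ← Real.rpow_neg hv0.le] at this
      linarith
    · have := Real.log_le_self hv0.le
      linarith
  calc _ ≤ (v + 2 * v ^ (-(1 / 2) : ℝ)) * Real.exp (-v) :=
        mul_le_mul_of_nonneg_right hle (Real.exp_pos _).le
    _ = _ := by ring

/-- Differentiating the Gamma integral at 1 under the integral sign gives Γ'(1) = -γ. -/
lemma integral_log_mul_exp_neg :
    ∫ v in Set.Ioi (0 : ℝ), Real.log v * Real.exp (-v) = -Real.eulerMascheroniConstant := by
  have h1 := Complex.hasDerivAt_GammaIntegral (s := 1) (by simp)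
  have h2 : Complex.Gamma =ᶠ[𝓝 1] Complex.GammaIntegral := by
    have : ∀ᶠ s : ℂ in 𝓝 1, 0 < s.re :=
      Complex.continuous_re.continuousAt.eventually (lt_mem_nhds (by simp))
    filter_upwards [this] with s hs using Complex.Gamma_eq_integral hs
  have h3 := (h1.congr_of_eventuallyEq h2).unique Complex.hasDerivAt_Gamma_one
  simp only [sub_self, Complex.cpow_zero, one_mul] at h3
  have h4 : ((∫ v in Set.Ioi (0 : ℝ), Real.log v * Real.exp (-v) : ℝ) : ℂ) =
      -(Real.eulerMascheroniConstant : ℂ) := by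
    rw [← h3, ← integral_complex_ofReal]
    simp
  exact_mod_cast h4

lemma primeInv_nonneg (k : ℕ) : 0 ≤ primeInv k := by
  unfold primeInv
  split_ifs <;> positivity

/-- The partial sums of the reciprocals of the primes. -/
noncomputable def sumPrimeInv (x : ℝ) : ℝ := ∑ k ∈ Finset.Icc 0 ⌊x⌋₊, primeInv k

lemma sumPrimeInv_nonneg (x : ℝ) : 0 ≤ sumPrimeInv x :=
  Finset.sum_nonneg fun _ _ => primeInv_nonneg _

lemma sumPrimeInv_mono : Monotone sumPrimeInv := fun _ _ h =>
  Finset.sum_le_sum_of_subset_of_nonneg (Finset.Icc_subset_Icc_right (Nat.floor_mono h))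
    fun _ _ _ => primeInv_nonneg _

/-- Abel summation with t = e^{v/σ}; this scaling moves σ out of the weight e^{-v}, ready for the
limit σ → 0⁺. -/
lemma LSeries_primeInv {σ : ℝ} (hσ : 0 < σ) :
    LSeries (fun n => (primeInv n : ℂ)) σ =
      ((∫ v in Set.Ioi (0 : ℝ), sumPrimeInv (Real.exp (v / σ)) * Real.exp (-v) : ℝ) : ℂ) := by
  have hsum : ∀ t : ℝ, ∑ k ∈ Finset.Icc 1 ⌊t⌋₊, primeInv k = sumPrimeInv t := fun t => by
    rw [sumPrimeInv, ← Finset.add_sum_Ioc_eq_sum_Icc (Nat.zero_le _),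
      ← Finset.Icc_add_one_left_eq_Ioc]
    simp [primeInv]
  -- The partial sums are O(log n), so any exponent strictly between 0 and σ serves.
  have hO : (fun n : ℕ => ∑ k ∈ Finset.Icc 1 n, primeInv k) =O[atTop]
      fun n : ℕ => (n : ℝ) ^ (σ / 2) := by
    have hle : (fun n : ℕ => ∑ k ∈ Finset.Icc 1 n, primeInv k) =O[atTop]
        fun n : ℕ => 1 + Real.log n := by
      refine IsBigO.of_bound 1 (Eventually.of_forall fun n => ?_)
      have h1 : ∑ k ∈ Finset.Icc 1 n, primeInv k ≤ 1 + Real.log n := by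
        refine le_trans ?_ (harmonic_le_one_add_log n)
        rw [harmonic_eq_sum_Icc]
        push_cast
        refine Finset.sum_le_sum fun k _ => ?_
        unfold primeInv
        split_ifs
        · rw [one_div]
        · positivity
      have h0 : 0 ≤ ∑ k ∈ Finset.Icc 1 n, primeInv k :=
        Finset.sum_nonneg fun _ _ => primeInv_nonneg _
      rw [Real.norm_of_nonneg h0, one_mul]
      exact h1.trans (le_abs_self _)
    refine hle.trans ?_
    have h2 : (fun x : ℝ => 1 + Real.log x) =O[atTop] fun x : ℝ => x ^ (σ / 2) := by
      refine IsBigO.add ?_ (isLittleO_log_rpow_atTop (by positivity)).isBigO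
      exact (isLittleO_const_left.2 (Or.inr (tendsto_norm_atTop_atTop.comp
        (tendsto_rpow_atTop (by positivity))))).isBigO
    exact h2.comp_tendsto tendsto_natCast_atTop_atTop
  rw [LSeries_eq_mul_integral_of_nonneg _ (r := σ / 2) (by positivity) (s := σ)
    (by simpa using hσ) hO primeInv_nonneg]
  have himg : (fun v : ℝ => Real.exp (v / σ)) '' Set.Ioi 0 = Set.Ioi 1 := by
    have : (fun v : ℝ => v / σ) '' Set.Ioi 0 = Set.Ioi 0 := by
      ext w
      refine ⟨?_, fun hw => ⟨w * σ, mul_pos hw hσ, by field_simp⟩⟩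
      rintro ⟨v, hv, rfl⟩
      exact div_pos hv hσ
    rw [show (fun v : ℝ => Real.exp (v / σ)) = Real.exp ∘ fun v => v / σ from rfl,
      Set.image_comp, this, Real.image_exp_Ioi, Real.exp_zero]
  have hinj : Set.InjOn (fun v : ℝ => Real.exp (v / σ)) (Set.Ioi 0) := fun v _ w _ h => by
    have := Real.exp_injective h
    field_simp at this
    exact this
  rw [← himg, integral_image_eq_integral_abs_deriv_smul measurableSet_Ioi
    (fun v _ => (((hasDerivAt_id' v).div_const σ).exp).hasDerivWithinAt) hinj,
    ← integral_complex_ofReal, ← integral_const_mul]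
  refine setIntegral_congr_fun measurableSet_Ioi fun v _ => ?_
  rw [abs_of_pos (by positivity), ← Complex.ofReal_sum, hsum, Complex.real_smul,
    Complex.cpow_def_of_ne_zero (Complex.ofReal_ne_zero.2 (Real.exp_pos _).ne'),
    ← Complex.ofReal_log (Real.exp_pos _).le, Real.log_exp]
  have hσ' : (σ : ℂ) ≠ 0 := Complex.ofReal_ne_zero.2 hσ.ne'
  have h1 : Complex.exp (((v / σ : ℝ) : ℂ) * -(σ + 1)) =
      Complex.exp (-(v / σ)) * Complex.exp (-v) := by
    rw [← Complex.exp_add]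
    congr 1
    push_cast
    field_simp
    ring
  have h2 : Complex.exp (v / σ) * Complex.exp (-(v / σ)) = 1 := by rw [← Complex.exp_add]; simp
  rw [h1]
  push_cast
  have h3 : (σ : ℂ) * (1 / σ) = 1 := by field_simp
  linear_combination (Complex.exp (v / σ) * Complex.exp (-(v / σ)) * sumPrimeInv (Real.exp (v / σ)) *
    Complex.exp (-v)) * h3 + (sumPrimeInv (Real.exp (v / σ)) * Complex.exp (-v)) * h2

/-- At e^{v/σ} the prime sum is log v - log σ + β + o(1). Adding log σ leaves β + log v, whose
integral against e^{-v} is β - γ. -/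
lemma tendsto_integral_sumPrimeInv {β : ℝ}
    (hβ : Tendsto (fun x : ℝ => sumPrimeInv x - Real.log (Real.log x)) atTop (𝓝 β)) :
    Tendsto (fun σ => (∫ v in Set.Ioi (0 : ℝ), sumPrimeInv (Real.exp (v / σ)) * Real.exp (-v)) +
      Real.log σ) (𝓝[>] 0) (𝓝 (β - Real.eulerMascheroniConstant)) := by
  have hβ' : Tendsto (fun w : ℝ => sumPrimeInv (Real.exp w) - Real.log w) atTop (𝓝 β) := by
    refine (hβ.comp Real.tendsto_exp_atTop).congr fun w => ?_
    simp
  -- Beyond `w0` the asymptotic formula supplies the dominating function; below it the prime sum is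
  -- at most its value at e^{w0}, and log σ ≥ log v - log w0.
  obtain ⟨w0, hw0⟩ := eventually_atTop.1 ((hβ'.abs.eventually (gt_mem_nhds
    (lt_add_one |β|))).and (eventually_ge_atTop 1))
  have hw1 : 1 ≤ w0 := (hw0 w0 le_rfl).2
  set C := |β| + 1 + sumPrimeInv (Real.exp w0) + Real.log w0 with hC
  have hlw0 : 0 ≤ Real.log w0 := Real.log_nonneg hw1
  have hbound : ∀ σ ∈ Set.Ioc (0 : ℝ) 1, ∀ v : ℝ, 0 < v →
      |sumPrimeInv (Real.exp (v / σ)) + Real.log σ| ≤ C + 2 * |Real.log v| := by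
    intro σ hσ v hv
    have hls : Real.log σ ≤ 0 := Real.log_nonpos hσ.1.le hσ.2
    have hld : Real.log (v / σ) = Real.log v - Real.log σ := Real.log_div hv.ne' hσ.1.ne'
    have hB0 := sumPrimeInv_nonneg (Real.exp w0)
    have hb := abs_nonneg β
    have hv1 := neg_abs_le (Real.log v)
    have hv2 := le_abs_self (Real.log v)
    rcases le_or_gt w0 (v / σ) with h | h
    · have h1 := abs_lt.1 (hw0 _ h).1
      rw [hld] at h1
      rw [abs_le]
      constructor <;> linarith [h1.1, h1.2]
    · have h1 := sumPrimeInv_nonneg (Real.exp (v / σ))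
      have h2 := sumPrimeInv_mono (Real.exp_le_exp.2 h.le)
      have h3 := Real.log_le_log (div_pos hv hσ.1) h.le
      rw [hld] at h3
      rw [abs_le]
      constructor <;> linarith
  have hexp : IntegrableOn (fun v => Real.exp (-v)) (Set.Ioi 0) := by
    simpa using exp_neg_integrableOn_Ioi 0 one_pos
  have hBm : Measurable sumPrimeInv := sumPrimeInv_mono.measurable
  have hdom : IntegrableOn (fun v => (C + 2 * |Real.log v|) * Real.exp (-v)) (Set.Ioi 0) := by
    refine ((hexp.const_mul C).add (integrableOn_log_mul_exp_neg.const_mul 2)).congr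
      (ae_of_all _ fun v => ?_)
    simp only [Pi.add_apply]
    ring
  have hbd : ∀ σ ∈ Set.Ioc (0 : ℝ) 1, ∀ᵐ v ∂(volume.restrict (Set.Ioi (0 : ℝ))),
      ‖(sumPrimeInv (Real.exp (v / σ)) + Real.log σ) * Real.exp (-v)‖ ≤
        (C + 2 * |Real.log v|) * Real.exp (-v) := by
    intro σ hσ
    filter_upwards [ae_restrict_mem measurableSet_Ioi] with v hv
    rw [norm_mul, Real.norm_of_nonneg (Real.exp_pos _).le]
    exact mul_le_mul_of_nonneg_right (hbound σ hσ v hv) (Real.exp_pos _).le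
  have hmem : ∀ᶠ σ : ℝ in 𝓝[>] 0, σ ∈ Set.Ioc (0 : ℝ) 1 := Ioc_mem_nhdsGT one_pos
  have hlogint : IntegrableOn (fun v => Real.log v * Real.exp (-v)) (Set.Ioi 0) :=
    Integrable.mono' integrableOn_log_mul_exp_neg (Measurable.aestronglyMeasurable (by fun_prop))
      (ae_of_all _ fun v => by rw [norm_mul, Real.norm_of_nonneg (Real.exp_pos _).le]; rfl)
  have hlim : Tendsto (fun σ => ∫ v in Set.Ioi (0 : ℝ),
      (sumPrimeInv (Real.exp (v / σ)) + Real.log σ) * Real.exp (-v)) (𝓝[>] 0)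
      (𝓝 (∫ v in Set.Ioi (0 : ℝ), (β + Real.log v) * Real.exp (-v))) := by
    refine tendsto_integral_filter_of_dominated_convergence _
      (Eventually.of_forall fun σ => Measurable.aestronglyMeasurable (by fun_prop))
      (hmem.mono hbd) hdom ?_
    filter_upwards [ae_restrict_mem measurableSet_Ioi] with v hv
    have hv0 : 0 < v := hv
    refine Tendsto.mul_const _ ?_
    have h1 : Tendsto (fun σ : ℝ => v / σ) (𝓝[>] 0) atTop :=
      tendsto_inv_nhdsGT_zero.const_mul_atTop hv0
    refine ((hβ'.comp h1).add_const (Real.log v)).congr' ?_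
    filter_upwards [hmem] with σ hσ
    simp only [Function.comp]
    rw [Real.log_div hv0.ne' hσ.1.ne']
    ring
  have hval : ∫ v in Set.Ioi (0 : ℝ), (β + Real.log v) * Real.exp (-v) =
      β - Real.eulerMascheroniConstant := by
    simp_rw [add_mul]
    rw [integral_add (hexp.const_mul β) hlogint, integral_log_mul_exp_neg, integral_const_mul,
      integral_exp_neg_Ioi_zero]
    ring
  rw [hval] at hlim
  refine hlim.congr' ?_
  filter_upwards [hmem] with σ hσ
  have hi : IntegrableOn (fun v => (sumPrimeInv (Real.exp (v / σ)) + Real.log σ) * Real.exp (-v))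
      (Set.Ioi 0) :=
    Integrable.mono' hdom (Measurable.aestronglyMeasurable (by fun_prop)) (hbd σ hσ)
  have h2 := integral_sub hi (hexp.const_mul (Real.log σ))
  rw [integral_const_mul, integral_exp_neg_Ioi_zero, mul_one] at h2
  rw [eq_sub_iff_add_eq] at h2
  rw [← h2]
  congr 1
  refine integral_congr_ae (ae_of_all _ fun v => ?_)
  simp only
  ring

/-- `-log (1 - k^{-s}) - k^{-s}` at the primes. -/
noncomputable def primeTail (s : ℝ) (k : ℕ) : ℝ :=
  if k.Prime then -Real.log (1 - (k : ℝ) ^ (-s)) - (k : ℝ) ^ (-s) else 0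

/-- For 0 < y ≤ 1/2, -log(1 - y) - y lies between 0 and 2y². Uniformity in s permits dominated
convergence at s = 1. -/
lemma abs_primeTail_le {s : ℝ} (hs : 1 ≤ s) (k : ℕ) :
    ‖primeTail s k‖ ≤ 2 * ((k : ℝ) ^ 2)⁻¹ := by
  unfold primeTail
  split_ifs with hk
  · have hk2 : (2 : ℝ) ≤ k := by exact_mod_cast hk.two_le
    set y := (k : ℝ) ^ (-s) with hy
    have hy0 : 0 < y := Real.rpow_pos_of_pos (by linarith) _
    have hy1 : y ≤ (k : ℝ)⁻¹ := by
      rw [← Real.rpow_neg_one]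
      exact Real.rpow_le_rpow_of_exponent_le (by linarith) (by linarith)
    have hk3 : (k : ℝ)⁻¹ ≤ 2⁻¹ := inv_anti₀ (by norm_num) hk2
    have h1 : 0 < 1 - y := by linarith
    have h2 := Real.log_le_sub_one_of_pos h1
    have h3 := Real.one_sub_inv_le_log_of_pos h1
    have h4 : (1 - y)⁻¹ ≤ 1 + y + 2 * y ^ 2 := by
      rw [inv_le_iff_one_le_mul₀ h1]
      nlinarith [sq_nonneg y, mul_pos hy0 hy0]
    have h5 : y ^ 2 ≤ ((k : ℝ) ^ 2)⁻¹ := by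
      rw [← inv_pow]
      exact pow_le_pow_left₀ hy0.le hy1 2
    rw [Real.norm_eq_abs, abs_le]
    constructor <;> nlinarith
  · simp

lemma summable_two_mul_inv_sq : Summable fun k : ℕ => 2 * ((k : ℝ) ^ 2)⁻¹ :=
  (Real.summable_nat_pow_inv.2 (by norm_num)).mul_left 2

lemma tendsto_tsum_primeTail :
    Tendsto (fun s => ∑' k, primeTail s k) (𝓝[>] 1) (𝓝 (∑' k, primeTail 1 k)) := by
  refine tendsto_tsum_of_dominated_convergence summable_two_mul_inv_sq (fun k => ?_) ?_
  · unfold primeTail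
    by_cases hk : k.Prime
    · simp only [hk, if_true]
      have hk2 : (2 : ℝ) ≤ k := by exact_mod_cast hk.two_le
      have h1 : Tendsto (fun s : ℝ => (k : ℝ) ^ (-s)) (𝓝[>] 1) (𝓝 ((k : ℝ) ^ (-1 : ℝ))) := by
        have : ContinuousAt (fun s : ℝ => (k : ℝ) ^ (-s)) 1 :=
          ContinuousAt.rpow continuousAt_const continuousAt_neg (Or.inl (by linarith))
        exact this.tendsto.mono_left nhdsWithin_le_nhds
      refine Tendsto.sub (Tendsto.neg (Tendsto.log (h1.const_sub 1) ?_)) h1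
      rw [Real.rpow_neg_one]
      have : (k : ℝ)⁻¹ ≤ 2⁻¹ := inv_anti₀ (by norm_num) hk2
      linarith
    · simp [hk]
  · filter_upwards [self_mem_nhdsWithin] with s hs k
    exact abs_primeTail_le (le_of_lt hs) k

lemma log_riemannZeta_eq {s : ℝ} (hs : 1 < s) : Real.log (riemannZeta s).re =
    ∑' k : ℕ, if k.Prime then -Real.log (1 - (k : ℝ) ^ (-s)) else 0 := by
  have h := riemannZeta_eulerProduct_exp_log (s := s) (by simpa using hs)
  have h1 : ∀ q : Nat.Primes, -Complex.log (1 - (q : ℂ) ^ (-(s : ℂ))) =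
      ((-Real.log (1 - ((q : ℕ) : ℝ) ^ (-s)) : ℝ) : ℂ) := by
    intro q
    have hq2 : (1 : ℝ) < (q : ℕ) := by exact_mod_cast q.2.one_lt
    have : ((q : ℕ) : ℝ) ^ (-s) ≤ 1 := Real.rpow_le_one_of_one_le_of_nonpos hq2.le (by linarith)
    rw [Complex.ofReal_neg, Complex.ofReal_log (by linarith)]
    push_cast
    rw [Complex.ofReal_cpow (by positivity)]
    simp
  simp_rw [h1] at h
  rw [← Complex.ofReal_tsum, ← Complex.ofReal_exp] at h
  rw [← h, Complex.ofReal_re, Real.log_exp]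
  have h2 := tsum_subtype {q : ℕ | q.Prime} fun k : ℕ => -Real.log (1 - (k : ℝ) ^ (-s))
  refine h2.trans (tsum_congr fun k => ?_)
  simp [Set.indicator_apply]

lemma LSeries_primeInv_eq_tsum {σ : ℝ} :
    LSeries (fun n => (primeInv n : ℂ)) σ =
      ((∑' k : ℕ, if k.Prime then (k : ℝ) ^ (-(1 + σ)) else 0 : ℝ) : ℂ) := by
  rw [LSeries, Complex.ofReal_tsum]
  refine tsum_congr fun k => ?_
  rcases eq_or_ne k 0 with rfl | hk
  · simp [Nat.not_prime_zero]
  · rw [LSeries.term_of_ne_zero hk]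
    have hk0 : (0 : ℝ) < k := by exact_mod_cast Nat.pos_of_ne_zero hk
    unfold primeInv
    split_ifs with hp
    · rw [neg_add, Real.rpow_add hk0, Real.rpow_neg_one, Real.rpow_neg hk0.le]
      push_cast
      rw [Complex.ofReal_cpow hk0.le]
      push_cast
      rw [div_eq_mul_inv, one_div]
    · simp

/-- The Euler product splits log ζ(s) into ∑ p^{-s} and the tail, so log ζ(s) + log(s - 1) tends to
β - γ plus the tail at 1. The simple pole of ζ with residue 1 makes the same limit 0. -/
lemma add_tsum_primeTail_eq {β : ℝ}
    (hβ : Tendsto (fun x : ℝ => sumPrimeInv x - Real.log (Real.log x)) atTop (𝓝 β)) :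
    β + ∑' k, primeTail 1 k = Real.eulerMascheroniConstant := by
  have hshift : Tendsto (fun s : ℝ => s - 1) (𝓝[>] 1) (𝓝[>] 0) := by
    refine tendsto_nhdsWithin_iff.2 ⟨?_, ?_⟩
    · have : Tendsto (fun s : ℝ => s - 1) (𝓝 1) (𝓝 (1 - 1)) := Continuous.tendsto (by fun_prop) 1
      rw [sub_self] at this
      exact this.mono_left nhdsWithin_le_nhds
    · filter_upwards [self_mem_nhdsWithin] with s hs
      exact Set.mem_Ioi.2 (sub_pos.2 (Set.mem_Ioi.1 hs))
  have h1 := (tendsto_integral_sumPrimeInv hβ).comp hshift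
  have h2 := h1.add tendsto_tsum_primeTail
  have h3 := log_riemannZeta_add_log_sub_isLittleO_ofReal.tendsto_div_nhds_zero
  simp only [div_one] at h3
  have h4 : Tendsto (fun s : ℝ => Real.log (riemannZeta s).re + Real.log (s - 1)) (𝓝[>] 1)
      (𝓝 (β - Real.eulerMascheroniConstant + ∑' k, primeTail 1 k)) := by
    refine h2.congr' ?_
    filter_upwards [self_mem_nhdsWithin] with s hs
    have hs1 : 1 < s := hs
    have e1 := (LSeries_primeInv (sub_pos.2 hs1)).symm.trans LSeries_primeInv_eq_tsum
    have e2 := Complex.ofReal_injective e1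
    rw [add_sub_cancel] at e2
    simp only [Function.comp]
    rw [e2, log_riemannZeta_eq hs1]
    have hsumm : Summable fun k : ℕ => if k.Prime then (k : ℝ) ^ (-s) else 0 := by
      refine Summable.of_nonneg_of_le (fun k => ?_) (fun k => ?_)
        (Real.summable_nat_rpow.2 (show -s < -1 by linarith))
      · split_ifs <;> positivity
      · split_ifs
        · rfl
        · positivity
    have htail : Summable (primeTail s) :=
      Summable.of_norm_bounded summable_two_mul_inv_sq (abs_primeTail_le hs1.le)
    rw [add_right_comm, ← hsumm.tsum_add htail]
    congr 1
    refine tsum_congr fun k => ?_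
    unfold primeTail
    split_ifs <;> ring
  have := tendsto_nhds_unique h3 h4
  linarith

/-- **Mertens' third theorem**. -/
theorem tendsto_W_mul_log :
    Tendsto (fun x => W x * Real.log x) atTop (𝓝 (Real.exp (-Real.eulerMascheroniConstant))) := by
  obtain ⟨β, hβ⟩ := exists_tendsto_sum_primeInv_sub_log_log
  have hsum := add_tsum_primeTail_eq hβ
  have htail : Summable (primeTail 1) :=
    Summable.of_norm_bounded summable_two_mul_inv_sq (abs_primeTail_le le_rfl)
  have h1 : Tendsto (fun x : ℝ => ∑ k ∈ Finset.range (⌊x⌋₊ + 1), primeTail 1 k) atTop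
      (𝓝 (∑' k, primeTail 1 k)) :=
    htail.hasSum.tendsto_sum_nat.comp ((tendsto_add_atTop_nat 1).comp tendsto_nat_floor_atTop)
  have h2 := hβ.add h1
  rw [hsum] at h2
  refine ((Real.continuous_exp.tendsto _).comp h2.neg).congr' ?_
  filter_upwards [eventually_gt_atTop 1] with x hx
  have hlx := Real.log_pos hx
  have hfac : ∀ q ∈ Nat.primesLE ⌊x⌋₊, 0 < 1 - 1 / (q : ℝ) := fun q hq => by
    have : (2 : ℝ) ≤ q := by exact_mod_cast Nat.two_le_of_mem_primesLE hq
    rw [sub_pos, div_lt_one (by linarith)]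
    linarith
  -- At s = 1 the tail is exactly the difference between -log(1 - 1/p) and 1/p.
  have hW : Real.log (W x) = -(∑ k ∈ Finset.Icc 0 ⌊x⌋₊, primeInv k +
      ∑ k ∈ Finset.range (⌊x⌋₊ + 1), primeTail 1 k) := by
    rw [W, Real.log_prod fun q hq => (hfac q hq).ne', Nat.primesLE_eq_filter_Icc_zero,
      Nat.range_succ_eq_Icc_zero, ← Finset.sum_add_distrib, Finset.sum_filter,
      ← Finset.sum_neg_distrib]
    refine Finset.sum_congr rfl fun k _ => ?_
    unfold primeInv primeTail
    split_ifs
    · rw [Real.rpow_neg_one, one_div]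
      ring
    · simp
  have hWpos : 0 < W x := Finset.prod_pos hfac
  simp only [Function.comp]
  rw [show -(∑ k ∈ Finset.Icc 0 ⌊x⌋₊, primeInv k - Real.log (Real.log x) +
      ∑ k ∈ Finset.range (⌊x⌋₊ + 1), primeTail 1 k) = Real.log (W x) + Real.log (Real.log x) by
    rw [hW]; ring, Real.exp_add, Real.exp_log hWpos, Real.exp_log hlx]

/-! ### Summation of W(√n) and the final asymptotics -/

lemma antitoneOn_one_div_log : AntitoneOn (fun t : ℝ => 1 / Real.log t) (Set.Ici 2) := by
  intro s hs t _ hst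
  have hs2 : (2 : ℝ) ≤ s := hs
  exact one_div_le_one_div_of_le (Real.log_pos (by linarith))
    (Real.log_le_log (by linarith) hst)

lemma li_mono {s t : ℝ} (hs : 2 ≤ s) (hst : s ≤ t) : li s ≤ li t := by
  have hint : ∀ {u v : ℝ}, 2 ≤ u → 2 ≤ v →
      IntervalIntegrable (fun t => 1 / Real.log t) volume u v := fun {u v} hu hv =>
    (antitoneOn_one_div_log.mono fun w hw => by
      have := hw.1
      exact (le_min hu hv).trans this).intervalIntegrable
  unfold li
  rw [← intervalIntegral.integral_add_adjacent_intervals (hint le_rfl hs) (hint hs (hs.trans hst))]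
  refine le_add_of_nonneg_right (intervalIntegral.integral_nonneg hst fun u hu => ?_)
  have := Real.log_pos (show 1 < u by linarith [hu.1])
  positivity

/-- The sum of `1 / log n` over `2 ≤ n < M + 2`. -/
noncomputable def sumInvLog (M : ℕ) : ℝ := ∑ i ∈ Finset.range M, 1 / Real.log (2 + i : ℝ)

lemma li_le_sumInvLog (M : ℕ) : li (2 + M) ≤ sumInvLog M :=
  AntitoneOn.integral_le_sum (f := fun t => 1 / Real.log t)
    (antitoneOn_one_div_log.mono Set.Icc_subset_Ici_self)

lemma sumInvLog_succ_le (M : ℕ) : sumInvLog (M + 1) ≤ li (2 + M) + 1 / Real.log 2 := by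
  have h := AntitoneOn.sum_le_integral (f := fun t => 1 / Real.log t) (x₀ := 2) (a := M)
    (antitoneOn_one_div_log.mono Set.Icc_subset_Ici_self)
  rw [sumInvLog, Finset.sum_range_succ']
  simp only [Nat.cast_zero, add_zero]
  exact add_le_add_left h _

lemma tendsto_li : Tendsto li atTop atTop :=
  li_isEquivalent.symm.tendsto_atTop tendsto_div_log_atTop

lemma tendsto_sumInvLog : Tendsto sumInvLog atTop atTop :=
  tendsto_atTop_mono li_le_sumInvLog
    (tendsto_li.comp (tendsto_atTop_add_const_left _ _ tendsto_natCast_atTop_atTop))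

/-- Since 1 / log t decreases, the sum and the integral differ by at most the first term 1 / log 2,
negligible because li tends to infinity. -/
lemma sumInvLog_floor_isEquivalent_li :
    (fun x : ℝ => sumInvLog (⌊x⌋₊ - 1)) ~[atTop] li := by
  have hO : (fun x : ℝ => sumInvLog (⌊x⌋₊ - 1) - li x) =O[atTop] fun _ => (1 : ℝ) := by
    refine IsBigO.of_bound (1 / Real.log 2) ?_
    filter_upwards [eventually_ge_atTop 2] with x hx
    obtain ⟨m, hm⟩ : ∃ m, ⌊x⌋₊ = m + 2 := Nat.exists_eq_add_of_le' (Nat.le_floor (by simpa using hx))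
    have h1 : (m : ℝ) + 2 ≤ x := by
      have := Nat.floor_le (show 0 ≤ x by linarith)
      rw [hm] at this
      exact_mod_cast this
    have h2 : x ≤ (m : ℝ) + 3 := by
      have := (Nat.lt_floor_add_one x).le
      rw [hm] at this
      push_cast at this
      linarith
    have h3 := li_le_sumInvLog (m + 1)
    have h4 := sumInvLog_succ_le m
    have h5 := li_mono hx (t := 2 + ((m + 1 : ℕ) : ℝ)) (by push_cast; linarith)
    have h6 := li_mono (s := 2 + (m : ℝ)) (t := x) (by linarith [m.cast_nonneg (α := ℝ)])
      (by linarith)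
    have h7 : 0 ≤ 1 / Real.log 2 := one_div_nonneg.2 (Real.log_nonneg (by norm_num))
    rw [hm, show m + 2 - 1 = m + 1 from rfl, norm_one, mul_one, Real.norm_eq_abs, abs_le]
    constructor <;> linarith
  exact hO.trans_isLittleO
    (isLittleO_const_left.2 (Or.inr (tendsto_norm_atTop_atTop.comp tendsto_li)))

/-- The factor 2 comes from log √n = (log n) / 2 in Mertens' theorem. -/
lemma W_sqrt_isEquivalent :
    (fun i : ℕ => W √((2 + i : ℕ) : ℝ)) ~[atTop]
      fun i : ℕ => 2 * Real.exp (-Real.eulerMascheroniConstant) * (1 / Real.log (2 + i : ℝ)) := by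
  have hpos : ∀ i : ℕ, 0 < Real.log (2 + i : ℝ) := fun i =>
    Real.log_pos (by linarith [i.cast_nonneg (α := ℝ)])
  have hc := Real.exp_pos (-Real.eulerMascheroniConstant)
  have hlim := tendsto_W_mul_log
  generalize Real.exp (-Real.eulerMascheroniConstant) = c at hc hlim ⊢
  have hne : ∀ i : ℕ, 2 * c * (1 / Real.log (2 + i : ℝ)) ≠ 0 := fun i =>
    (mul_pos (mul_pos two_pos hc) (one_div_pos.2 (hpos i))).ne'
  refine (isEquivalent_iff_tendsto_one (Eventually.of_forall hne)).2 ?_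
  have h1 : Tendsto (fun i : ℕ => √((2 + i : ℕ) : ℝ)) atTop atTop :=
    Real.tendsto_sqrt_atTop.comp (tendsto_natCast_atTop_atTop.comp
      (tendsto_atTop_mono (Nat.le_add_left · 2) tendsto_id))
  have h2 := (hlim.comp h1).div_const c
  rw [div_self hc.ne'] at h2
  refine h2.congr fun i => ?_
  have h3 := (hpos i).ne'
  have h4 := hc.ne'
  simp only [Function.comp_apply, Pi.div_apply]
  rw [Real.log_sqrt (Nat.cast_nonneg _), Nat.cast_add, Nat.cast_ofNat]
  field_simp

/-- Equivalence of terms passes to partial sums because the comparison series ∑ 1 / log n is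
nonnegative and divergent. -/
lemma sum_W_isEquivalent_li :
    (fun x : ℝ => ∑ n ∈ Finset.Icc 2 ⌊x⌋₊, W √(n : ℝ)) ~[atTop]
      fun x => 2 * Real.exp (-Real.eulerMascheroniConstant) * li x := by
  have hc : 0 < 2 * Real.exp (-Real.eulerMascheroniConstant) := by positivity
  have h1 := IsLittleO.sum_range W_sqrt_isEquivalent.isLittleO
    (fun i => by
      have := Real.log_nonneg (show (1 : ℝ) ≤ 2 + i by linarith [i.cast_nonneg (α := ℝ)])
      simp only [Pi.zero_apply]
      positivity)
    (by
      simp_rw [← Finset.mul_sum]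
      exact tendsto_sumInvLog.const_mul_atTop hc)
  simp_rw [Pi.sub_apply, Finset.sum_sub_distrib, ← Finset.mul_sum] at h1
  have h2 : (fun M : ℕ => ∑ i ∈ Finset.range M, W √((2 + i : ℕ) : ℝ)) ~[atTop]
      fun M => 2 * Real.exp (-Real.eulerMascheroniConstant) * sumInvLog M := h1
  have hfl : Tendsto (fun x : ℝ => ⌊x⌋₊ - 1) atTop atTop :=
    (tendsto_sub_atTop_nat 1).comp tendsto_nat_floor_atTop
  have h3 := h2.comp_tendsto hfl
  have h4 : (fun x : ℝ => 2 * Real.exp (-Real.eulerMascheroniConstant) *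
      sumInvLog (⌊x⌋₊ - 1)) ~[atTop]
      fun x => 2 * Real.exp (-Real.eulerMascheroniConstant) * li x :=
    IsEquivalent.refl.mul sumInvLog_floor_isEquivalent_li
  refine (h3.trans h4).congr_left (Eventually.of_forall fun x => ?_)
  simp only [Function.comp]
  rw [← Finset.Ico_add_one_right_eq_Icc, Finset.sum_Ico_eq_sum_range]
  rfl

lemma li_isEquivalent_primePi : li ~[atTop] fun x : ℝ => (primePi x : ℝ) :=
  li_isEquivalent.trans primePi_isEquivalent.symm

end RandomPrimes

theorem mainTheorem5 :
    -- the expected value, for the shift with independent uniform residues modulo all primes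
    (∀ x : ℝ, 1 ≤ x →
      Integrable (fun a => RandomPrimes.piRM a x) RandomPrimes.rmLaw ∧
      (∫ a, RandomPrimes.piRM a x ∂(RandomPrimes.rmLaw)) =
        ∑ n ∈ Finset.Icc 2 ⌊x⌋₊, RandomPrimes.W √(n : ℝ)) ∧
    -- the same for an integer shift with independent uniform residues modulo the primes `≤ √x`
    (∀ x : ℝ, 1 ≤ x →
      ∀ (Ω : Type*) [MeasurableSpace Ω] (P : Measure Ω) [IsProbabilityMeasure P] (a : Ω → ℤ),
        RandomPrimes.IsRandomShift P a (RandomPrimes.primePi √x) →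
        Integrable (fun ω => RandomPrimes.piRM (RandomPrimes.intShift (a ω)) x) P ∧
        (∫ ω, RandomPrimes.piRM (RandomPrimes.intShift (a ω)) x ∂P) =
          ∑ n ∈ Finset.Icc 2 ⌊x⌋₊, RandomPrimes.W √(n : ℝ)) ∧
    -- the asymptotics as `x → ∞`
    (fun x : ℝ => ∫ a, RandomPrimes.piRM a x ∂(RandomPrimes.rmLaw)) ~[atTop]
      (fun x : ℝ => 2 * Real.exp (-Real.eulerMascheroniConstant) * RandomPrimes.li x) ∧
    (fun x : ℝ => ∫ a, RandomPrimes.piRM a x ∂(RandomPrimes.rmLaw)) ~[atTop]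
      (fun x : ℝ => 2 * Real.exp (-Real.eulerMascheroniConstant) *
        (RandomPrimes.primePi x : ℝ)) := by
  have hE : ∀ x : ℝ, 1 ≤ x → ∫ a, RandomPrimes.piRM a x ∂(RandomPrimes.rmLaw) =
      ∑ n ∈ Finset.Icc 2 ⌊x⌋₊, RandomPrimes.W √(n : ℝ) := fun x hx =>
    (RandomPrimes.integrable_piRM_and_integral_piRM hx (RandomPrimes.uniformResidues_rmLaw _)).2
  have hli : (fun x : ℝ => ∫ a, RandomPrimes.piRM a x ∂(RandomPrimes.rmLaw)) ~[atTop]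
      (fun x : ℝ => 2 * Real.exp (-Real.eulerMascheroniConstant) * RandomPrimes.li x) := by
    refine RandomPrimes.sum_W_isEquivalent_li.congr_left ?_
    filter_upwards [eventually_ge_atTop 1] with x hx using (hE x hx).symm
  refine ⟨fun x hx => RandomPrimes.integrable_piRM_and_integral_piRM hx
    (RandomPrimes.uniformResidues_rmLaw _), fun x hx Ω _ P _ a ha =>
    RandomPrimes.integrable_piRM_and_integral_piRM hx ha.uniformResidues, hli, hli.trans ?_⟩
  exact IsEquivalent.refl.mul RandomPrimes.li_isEquivalent_primePi
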